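/- Let $N\ge 2$ be an integer. There is exactly one $N$-tuple of real numbers $x_1>x_2>\dots>x_N$ with $x_1+\dots+x_N=0$ that satisfies the many-interacting-worlds recursion $$x_{n+1}=x_n-\frac{1}{x_1+\dots+x_n},\qquad 1\le n\le N-1 .$$ Let $\mathbb{P}_N$ be its empirical distribution, $\mathbb{P}_N(A)=\#\{n: x_n\in A\}/N$ for Borel sets $A\subseteq\mathbb{R}$, and let $\gamma$ be the standard normal distribution on $\mathbb{R}$. For probability measures $\mu,\nu$ on $\mathbb{R}$ (with finite first moments in the second definition) let $$d_K(\mu,\nu)=\sup_{z\in\mathbb{R}}\bigl|\mu((-\infty,z])-\nu((-\infty,z])\bigr|,\qquad d_W(\mu,\nu)=\sup_{h}\Bigl|\int_{\mathbb{R}} h\,d\mu-\int_{\mathbb{R}} h\,d\nu\Bigr|,$$ where the second supremum is over all $h:\mathbb{R}\to\mathbb{R}$ with $|h(x)-h(y)|\le|x-y|$ for all $x,y$. Then there is a constant $C>0$, not depending on $N$, such that for every $N\ge 2$ $$\frac{1}{2N}\le d_K(\mathbb{P}_N,\gamma)\le\frac{55}{N} \qquad\text{and}\qquad \frac{\sqrt{\log(N/2)}}{2N}-\frac{C}{N}\le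 d_W(\mathbb{P}_N,\gamma)\le\frac{16\sqrt{\log N}}{N}.$$ -/

import Mathlib

open MeasureTheory ProbabilityTheory
open scoped ENNReal NNReal

/-- A strictly decreasing, zero-mean solution `x_1 > ⋯ > x_N` of the many-interacting-worlds
recursion `x_{n+1} = x_n - 1 / (x_1 + ⋯ + x_n)`, `1 ≤ n ≤ N - 1`.
The locations are indexed from `0`: `x ⟨n, _⟩` is `x_{n+1}`. The partial sums in the denominators
are automatically nonzero, because `1 / 0 = 0` would give `x_{n+1} = x_n`, contradicting strict
monotonicity. -/
structure IsMIWSolution (N : ℕ) (x : Fin N → ℝ) : Prop where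
  recursion : ∀ (n : ℕ) (h : n + 1 < N),
    x ⟨n + 1, h⟩ = x ⟨n, n.lt_of_succ_lt h⟩ - 1 / ∑ i ∈ Finset.Iic ⟨n, n.lt_of_succ_lt h⟩, x i
  zeroMean : ∑ i, x i = 0
  strictAnti : StrictAnti x

/-- The empirical distribution of the points `x_1, …, x_N`: the measure putting mass `1 / N` at
each of them. -/
noncomputable def empiricalDistribution {N : ℕ} (x : Fin N → ℝ) : Measure ℝ :=
  (N : ℝ≥0∞)⁻¹ • ∑ i, Measure.dirac (x i)

/-- The empirical distribution gives a measurable set `A` the mass `#{n : x_n ∈ A} / N`. -/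
theorem empiricalDistribution_apply {N : ℕ} (x : Fin N → ℝ) {A : Set ℝ} (hA : MeasurableSet A) :
    empiricalDistribution x A = (Nat.card {n : Fin N // x n ∈ A} : ℝ≥0∞) / N := by
  classical
  simp only [empiricalDistribution, Measure.smul_apply, Measure.finsetSum_apply,
    Measure.dirac_apply' _ hA, smul_eq_mul, Set.indicator_apply, Pi.one_apply]
  rw [Finset.sum_boole, Nat.card_eq_fintype_card, Fintype.card_subtype, mul_comm, div_eq_mul_inv]

/-- The Kolmogorov distance `sup_z |μ (-∞, z] - ν (-∞, z]|` between two probability measures on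
`ℝ`, as an extended nonnegative real. -/
noncomputable def kolmogorovDist (μ ν : Measure ℝ) : ℝ≥0∞ :=
  ⨆ z : ℝ, ENNReal.ofReal |μ.real (Set.Iic z) - ν.real (Set.Iic z)|

/-- The Wasserstein distance `sup |∫ h dμ - ∫ h dν|`, over all `1`-Lipschitz `h : ℝ → ℝ`, between
two probability measures on `ℝ` with finite first moment, as an extended nonnegative real. -/
noncomputable def wassersteinDist (μ ν : Measure ℝ) : ℝ≥0∞ :=
  ⨆ (h : ℝ → ℝ) (_ : LipschitzWith 1 h), ENNReal.ofReal |∫ t, h t ∂μ - ∫ t, h t ∂ν|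

/-!
The points are described through their partial sums `S n = x_1 + ⋯ + x_n`, which are positive for
`n < N`, with `S N = 0`, and satisfy `S n * (x_n - x_{n+1}) = 1`. Summation by parts gives the
discrete Stein identity
`∑ x_n f(x_n) = ∑ S n * (f(x_n) - f(x_{n+1}))`
for every function `f` (`IsMIWSequence.sum_mul_eq`); its right-hand side is the sum, over the gaps,
of the mean value of `f'` on the gap.

*Existence and uniqueness.* The recursion started at `c` is monotone in `c` as long as the partial
sums stay positive, which gives uniqueness and hence the symmetry of the solution under
`x ↦ -x`. A root of the last partial sum is found by the intermediate value theorem, by induction on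
the number of points (`exists_shoot_eq_zero`).

*Kolmogorov distance.* Let `f` be the Stein solution for the half-line `(-∞, z]`. Its derivative is
the sum of the increasing function `w f(w)`, with values in `[Φ(z) - 1, Φ(z)]` by Mills ratio
inequalities, and of the decreasing function `1_{w ≤ z} - Φ(z)`. Bounding the mean values of `f'` by
endpoint values turns the Stein identity into a telescoping sum, and the distance is at most `1 / N`
(`IsMIWSequence.abs_sum_indicator_sub_le`). The lower bound comes from the jump of size `1 / N` at
`x_1`.

*Wasserstein distance, upper bound.* For Lipschitz `h` the difference of the means is an integral of
`h'` against the difference of the distribution functions. On `[-x_1, x_1]` the latter is at most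
`1 / N`, and the normal tail outside contributes at most `2 / (N x_1)`. The bound
`x_1 ^ 2 ≤ 3 + 2 log N` holds because `x_n ^ 2 + 2 log (S (n - 1))` increases along the solution
(`IsMIWSequence.first_sq_le`).

*Wasserstein distance, lower bound.* Let `k` be a row of tents, the distance to the nearest point,
over the gaps inside `[-x_m, x_m]`, and let `F` be its primitive. The function `k(w) - w F(w)` has
mean zero under the normal distribution, while its mean under the empirical distribution is, by the
Stein identity, at most `-x_m / (2 N)`: a tent over a gap of length `ℓ = 1 / S` contributes
`S * ℓ ^ 2 / 4 = ℓ / 4`. If all gaps in `[-x_m, x_m]` are shorter than `1 / K`, then the Lipschitz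
constant of this function is at most `1 + 2 x_m / K`. The choice `K = 1 + x_1 ^ 2` makes the loss
harmless, and `x_m ^ 2 ≥ log (N / 2)` for large `N` because `x_n ^ 2 + 2 log (S n)` decreases along
the solution (`IsMIWSequence.exists_sqrt_log_le`).
-/

/-! ### The Mills ratio of the standard normal distribution -/

/-- The distribution function of the standard normal distribution. -/
noncomputable def stdNormalCDF (w : ℝ) : ℝ := (gaussianReal 0 1).real (Set.Iic w)

/-- The density of the standard normal distribution. -/
noncomputable def stdNormalPDF (w : ℝ) : ℝ := gaussianPDFReal 0 1 w

theorem stdNormalPDF_pos (w : ℝ) : 0 < stdNormalPDF w := gaussianPDFReal_pos 0 1 w one_ne_zero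

theorem hasDerivAt_stdNormalPDF (w : ℝ) :
    HasDerivAt stdNormalPDF (-w * stdNormalPDF w) w := by
  have hdef : stdNormalPDF = fun x => (√(2 * Real.pi * 1))⁻¹ * Real.exp (-x ^ 2 / 2) := by
    funext x
    simp [stdNormalPDF, gaussianPDFReal]
  have h : HasDerivAt (fun x : ℝ => -x ^ 2 / 2) (-w) w := by
    have := ((hasDerivAt_pow 2 w).neg).div_const 2
    refine this.congr_deriv ?_
    simp only [Nat.cast_ofNat, Nat.add_one_sub_one, pow_one]
    ring
  rw [hdef]
  refine (h.exp.const_mul _).congr_deriv ?_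
  ring

theorem continuous_stdNormalPDF : Continuous stdNormalPDF :=
  continuous_iff_continuousAt.2 fun w => (hasDerivAt_stdNormalPDF w).continuousAt

theorem integrable_stdNormalPDF : Integrable stdNormalPDF := integrable_gaussianPDFReal 0 1

theorem integrable_gaussianReal_iff {f : ℝ → ℝ} :
    Integrable f (gaussianReal 0 1) ↔ Integrable fun t => f t * stdNormalPDF t := by
  rw [gaussianReal_of_var_ne_zero _ one_ne_zero,
    integrable_withDensity_iff (measurable_gaussianPDF 0 1)
      (Filter.Eventually.of_forall fun _ => gaussianPDF_lt_top)]
  simp only [toReal_gaussianPDF, stdNormalPDF]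

theorem integrable_id_gaussianReal : Integrable (fun t : ℝ => t) (gaussianReal 0 1) :=
  (memLp_id_gaussianReal (μ := 0) (v := 1) 1).integrable le_rfl

theorem integrable_mul_stdNormalPDF : Integrable fun t : ℝ => t * stdNormalPDF t :=
  integrable_gaussianReal_iff.1 integrable_id_gaussianReal

theorem integrable_sq_mul_stdNormalPDF : Integrable fun t : ℝ => t ^ 2 * stdNormalPDF t :=
  integrable_gaussianReal_iff.1 (memLp_id_gaussianReal (μ := 0) (v := 1) 2).integrable_sq

theorem stdNormalCDF_eq_integral (w : ℝ) : stdNormalCDF w = ∫ t in Set.Iic w, stdNormalPDF t := by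
  rw [stdNormalCDF, measureReal_def, gaussianReal_apply_eq_integral 0 one_ne_zero,
    ENNReal.toReal_ofReal]
  · rfl
  · exact integral_nonneg fun t => gaussianPDFReal_nonneg 0 1 t

theorem hasDerivAt_stdNormalCDF (w : ℝ) : HasDerivAt stdNormalCDF (stdNormalPDF w) w := by
  have h : stdNormalCDF = fun u => (∫ t in (0:ℝ)..u, stdNormalPDF t) + stdNormalCDF 0 := by
    funext u
    rw [stdNormalCDF_eq_integral, stdNormalCDF_eq_integral, ← sub_eq_iff_eq_add]
    exact intervalIntegral.integral_Iic_sub_Iic integrable_stdNormalPDF.integrableOn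
      integrable_stdNormalPDF.integrableOn
  rw [h]
  exact (intervalIntegral.integral_hasDerivAt_right
    integrable_stdNormalPDF.intervalIntegrable
    continuous_stdNormalPDF.stronglyMeasurable.stronglyMeasurableAtFilter
    continuous_stdNormalPDF.continuousAt).add_const _

theorem stdNormalCDF_nonneg (w : ℝ) : 0 ≤ stdNormalCDF w := measureReal_nonneg

theorem stdNormalCDF_le_one (w : ℝ) : stdNormalCDF w ≤ 1 := measureReal_le_one

theorem stdNormalCDF_neg (w : ℝ) : stdNormalCDF (-w) = 1 - stdNormalCDF w := by
  have h1 : (gaussianReal 0 1).real (Set.Ici w) = (gaussianReal 0 1).real (Set.Iic (-w)) := by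
    have h := gaussianReal_map_neg (μ := 0) (v := 1)
    rw [neg_zero] at h
    conv_rhs => rw [← h]
    rw [map_measureReal_apply measurable_neg measurableSet_Iic]
    congr 1
    ext t
    simp
  have h2 : (gaussianReal 0 1).real (Set.Ici w) = (gaussianReal 0 1).real (Set.Ioi w) := by
    have := nullSingletonClass_gaussianReal (μ := 0) (v := 1) one_ne_zero
    exact measureReal_congr Ioi_ae_eq_Ici.symm
  rw [stdNormalCDF, ← h1, h2, ← Set.compl_Iic, probReal_compl_eq_one_sub measurableSet_Iic]
  rfl

theorem integral_Iic_mul_stdNormalPDF (w : ℝ) :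
    ∫ t in Set.Iic w, t * stdNormalPDF t = -stdNormalPDF w := by
  have hd : ∀ x ∈ Set.Iic w, HasDerivAt (fun t => -stdNormalPDF t) (x * stdNormalPDF x) x :=
    fun x _ => (hasDerivAt_stdNormalPDF x).neg.congr_deriv (by ring)
  rw [integral_Iic_of_hasDerivAt_of_tendsto' hd integrable_mul_stdNormalPDF.integrableOn
    (tendsto_zero_of_hasDerivAt_of_integrableOn_Iic hd integrable_mul_stdNormalPDF.integrableOn
      integrable_stdNormalPDF.neg.integrableOn), sub_zero]

theorem integral_Iic_sq_mul_stdNormalPDF (w : ℝ) :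
    ∫ t in Set.Iic w, t ^ 2 * stdNormalPDF t = stdNormalCDF w - w * stdNormalPDF w := by
  have hi : Integrable fun t => stdNormalPDF t - t ^ 2 * stdNormalPDF t :=
    integrable_stdNormalPDF.sub integrable_sq_mul_stdNormalPDF
  have hd : ∀ x ∈ Set.Iic w, HasDerivAt (fun t => t * stdNormalPDF t)
      (stdNormalPDF x - x ^ 2 * stdNormalPDF x) x :=
    fun x _ => ((hasDerivAt_id x).mul (hasDerivAt_stdNormalPDF x)).congr_deriv (by simp; ring)
  have h := integral_Iic_of_hasDerivAt_of_tendsto' hd hi.integrableOn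
    (tendsto_zero_of_hasDerivAt_of_integrableOn_Iic hd hi.integrableOn
      integrable_mul_stdNormalPDF.integrableOn)
  rw [integral_sub integrable_stdNormalPDF.integrableOn
    integrable_sq_mul_stdNormalPDF.integrableOn, ← stdNormalCDF_eq_integral] at h
  linarith

/-- The expected excess `E (w - Z)⁺` of a standard normal `Z`. -/
theorem integral_Iic_sub_mul_stdNormalPDF (w : ℝ) :
    ∫ t in Set.Iic w, (w - t) * stdNormalPDF t = w * stdNormalCDF w + stdNormalPDF w := by
  simp_rw [sub_mul]
  rw [integral_sub (integrable_stdNormalPDF.const_mul w).integrableOn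
    integrable_mul_stdNormalPDF.integrableOn, integral_const_mul, ← stdNormalCDF_eq_integral,
    integral_Iic_mul_stdNormalPDF]
  ring

theorem mul_stdNormalCDF_add_stdNormalPDF_nonneg (w : ℝ) :
    0 ≤ w * stdNormalCDF w + stdNormalPDF w := by
  rw [← integral_Iic_sub_mul_stdNormalPDF]
  exact setIntegral_nonneg measurableSet_Iic fun t ht =>
    mul_nonneg (sub_nonneg.2 ht) (stdNormalPDF_pos t).le

/-- The Mills ratio inequality in the form `0 ≤ (1 + w ^ 2) Φ(w) + w φ(w)`: the right-hand side is
the second moment `E ((w - Z)⁺) ^ 2` of a standard normal `Z`. -/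
theorem one_add_sq_mul_stdNormalCDF_add_nonneg (w : ℝ) :
    0 ≤ (1 + w ^ 2) * stdNormalCDF w + w * stdNormalPDF w := by
  have h : ∫ t in Set.Iic w, (w - t) ^ 2 * stdNormalPDF t =
      (1 + w ^ 2) * stdNormalCDF w + w * stdNormalPDF w := by
    have he : ∀ t, (w - t) ^ 2 * stdNormalPDF t = w ^ 2 * stdNormalPDF t
        - (2 * w) * (t * stdNormalPDF t) + t ^ 2 * stdNormalPDF t := fun t => by ring
    have hi : Integrable fun t => w ^ 2 * stdNormalPDF t - (2 * w) * (t * stdNormalPDF t) :=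
      (integrable_stdNormalPDF.const_mul _).sub (integrable_mul_stdNormalPDF.const_mul _)
    simp_rw [he]
    rw [integral_add hi.integrableOn
        integrable_sq_mul_stdNormalPDF.integrableOn,
      integral_sub (integrable_stdNormalPDF.const_mul _).integrableOn
        (integrable_mul_stdNormalPDF.const_mul _).integrableOn,
      integral_const_mul, integral_const_mul, ← stdNormalCDF_eq_integral,
      integral_Iic_mul_stdNormalPDF, integral_Iic_sq_mul_stdNormalPDF]
    ring
  rw [← h]
  exact setIntegral_nonneg measurableSet_Iic fun t _ =>
    mul_nonneg (sq_nonneg _) (stdNormalPDF_pos t).le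

/-- The (reflected) Mills ratio `Φ / φ` of the standard normal distribution. -/
noncomputable def millsRatio (w : ℝ) : ℝ := stdNormalCDF w / stdNormalPDF w

theorem hasDerivAt_millsRatio (w : ℝ) : HasDerivAt millsRatio (1 + w * millsRatio w) w := by
  have hp := (stdNormalPDF_pos w).ne'
  refine ((hasDerivAt_stdNormalCDF w).div (hasDerivAt_stdNormalPDF w) hp).congr_deriv ?_
  rw [millsRatio]
  field_simp
  ring

theorem monotone_mul_millsRatio : Monotone fun w => w * millsRatio w := by
  have hd : ∀ w, HasDerivAt (fun w => w * millsRatio w)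
      (millsRatio w + w * (1 + w * millsRatio w)) w := fun w =>
    ((hasDerivAt_id w).mul (hasDerivAt_millsRatio w)).congr_deriv (by simp)
  refine monotone_of_deriv_nonneg (fun w => (hd w).differentiableAt) fun w => ?_
  rw [(hd w).deriv]
  have hp := stdNormalPDF_pos w
  have : millsRatio w + w * (1 + w * millsRatio w) =
      ((1 + w ^ 2) * stdNormalCDF w + w * stdNormalPDF w) / stdNormalPDF w := by
    rw [millsRatio]
    field_simp
    ring
  rw [this]
  exact div_nonneg (one_add_sq_mul_stdNormalCDF_add_nonneg w) hp.le

theorem neg_one_le_mul_millsRatio (w : ℝ) : -1 ≤ w * millsRatio w := by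
  have hp := stdNormalPDF_pos w
  have : w * millsRatio w + 1 = (w * stdNormalCDF w + stdNormalPDF w) / stdNormalPDF w := by
    rw [millsRatio]
    field_simp
  have h2 := div_nonneg (mul_stdNormalCDF_add_stdNormalPDF_nonneg w) hp.le
  linarith

theorem millsRatio_sub_bounds {a b : ℝ} (hab : a ≤ b) :
    (b - a) * (1 + a * millsRatio a) ≤ millsRatio b - millsRatio a ∧
      millsRatio b - millsRatio a ≤ (b - a) * (1 + b * millsRatio b) := by
  rcases hab.eq_or_lt with rfl | hlt
  · simp
  obtain ⟨c, hc, hce⟩ := exists_hasDerivAt_eq_slope millsRatio (fun w => 1 + w * millsRatio w) hlt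
    (fun w _ => (hasDerivAt_millsRatio w).continuousAt.continuousWithinAt)
    fun w _ => hasDerivAt_millsRatio w
  have hpos : 0 < b - a := sub_pos.2 hlt
  rw [eq_div_iff hpos.ne'] at hce
  rw [← hce, mul_comm (b - a), mul_comm (b - a)]
  have h1 := monotone_mul_millsRatio hc.1.le
  have h2 := monotone_mul_millsRatio hc.2.le
  simp only at h1 h2
  constructor <;> gcongr

/-! ### The Stein solution for half-lines -/

/-- The bounded solution `f` of Stein's equation `f' w - w f w = 1_{w ≤ z} - Φ(z)`. -/
noncomputable def steinSolution (z w : ℝ) : ℝ :=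
  if w ≤ z then (1 - stdNormalCDF z) * millsRatio w else stdNormalCDF z * millsRatio (-w)

theorem steinSolution_of_le {z w : ℝ} (h : w ≤ z) :
    steinSolution z w = (1 - stdNormalCDF z) * millsRatio w := if_pos h

theorem stdNormalPDF_neg (w : ℝ) : stdNormalPDF (-w) = stdNormalPDF w := by
  simp [stdNormalPDF, gaussianPDFReal]

theorem steinSolution_of_ge {z w : ℝ} (h : z ≤ w) :
    steinSolution z w = stdNormalCDF z * millsRatio (-w) := by
  rcases h.eq_or_lt with rfl | hlt
  · rw [steinSolution_of_le le_rfl, millsRatio, millsRatio, stdNormalCDF_neg, stdNormalPDF_neg]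
    ring
  · exact if_neg (not_le.2 hlt)

theorem monotone_mul_steinSolution (z : ℝ) : Monotone fun w => w * steinSolution z w := by
  have h1 : MonotoneOn (fun w => w * steinSolution z w) (Set.Iic z) := by
    intro a ha b hb hab
    simp only [steinSolution_of_le (Set.mem_Iic.1 ha), steinSolution_of_le (Set.mem_Iic.1 hb)]
    have h := mul_le_mul_of_nonneg_left (monotone_mul_millsRatio hab)
      (sub_nonneg.2 (stdNormalCDF_le_one z))
    simp only at h
    linarith
  have h2 : MonotoneOn (fun w => w * steinSolution z w) (Set.Ici z) := by
    intro a ha b hb hab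
    simp only [steinSolution_of_ge (Set.mem_Ici.1 ha), steinSolution_of_ge (Set.mem_Ici.1 hb)]
    have h := mul_le_mul_of_nonneg_left (monotone_mul_millsRatio (neg_le_neg hab))
      (stdNormalCDF_nonneg z)
    simp only at h
    linarith
  exact h1.Iic_union_Ici h2

theorem stdNormalCDF_sub_one_le_mul_steinSolution (z w : ℝ) :
    stdNormalCDF z - 1 ≤ w * steinSolution z w := by
  have h := monotone_mul_steinSolution z (min_le_left w z)
  have h2 := mul_le_mul_of_nonneg_left (neg_one_le_mul_millsRatio (min w z))
      (sub_nonneg.2 (stdNormalCDF_le_one z))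
  simp only [steinSolution_of_le (min_le_right w z)] at h
  linarith

theorem mul_steinSolution_le (z w : ℝ) : w * steinSolution z w ≤ stdNormalCDF z := by
  have h := monotone_mul_steinSolution z (le_max_left w z)
  have h2 := mul_le_mul_of_nonneg_left (neg_one_le_mul_millsRatio (-max w z))
      (stdNormalCDF_nonneg z)
  simp only [steinSolution_of_ge (le_max_right w z)] at h
  linarith

theorem steinSolution_sub_bounds_of_le {z a b : ℝ} (hab : a ≤ b) (hbz : b ≤ z) :
    (b - a) * (a * steinSolution z a + 1 - stdNormalCDF z) ≤
        steinSolution z b - steinSolution z a ∧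
      steinSolution z b - steinSolution z a ≤
        (b - a) * (b * steinSolution z b + 1 - stdNormalCDF z) := by
  rw [steinSolution_of_le hbz, steinSolution_of_le (hab.trans hbz)]
  have h := millsRatio_sub_bounds hab
  have hc := sub_nonneg.2 (stdNormalCDF_le_one z)
  have h1 := mul_le_mul_of_nonneg_left h.1 hc
  have h2 := mul_le_mul_of_nonneg_left h.2 hc
  constructor <;> linarith

theorem steinSolution_sub_bounds_of_ge {z a b : ℝ} (hab : a ≤ b) (hza : z ≤ a) :
    (b - a) * (a * steinSolution z a - stdNormalCDF z) ≤
        steinSolution z b - steinSolution z a ∧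
      steinSolution z b - steinSolution z a ≤
        (b - a) * (b * steinSolution z b - stdNormalCDF z) := by
  rw [steinSolution_of_ge hza, steinSolution_of_ge (hza.trans hab)]
  have h := millsRatio_sub_bounds (neg_le_neg hab)
  have hc := stdNormalCDF_nonneg z
  have h1 := mul_le_mul_of_nonneg_left h.1 hc
  have h2 := mul_le_mul_of_nonneg_left h.2 hc
  constructor <;> linarith

/-- The mean of `f'` over `[a, b]`, for `f` the Stein solution: since `f' w` is `w f w`, which is
increasing, plus `1_{w ≤ z} - Φ(z)`, which is decreasing, it can be bounded by endpoint values. -/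
theorem steinSolution_sub_bounds {z a b : ℝ} (hab : a ≤ b) :
    (b - a) * (a * steinSolution z a + (Set.Iic z).indicator 1 b - stdNormalCDF z) ≤
        steinSolution z b - steinSolution z a ∧
      steinSolution z b - steinSolution z a ≤
        (b - a) * (b * steinSolution z b + (Set.Iic z).indicator 1 a - stdNormalCDF z) := by
  simp only [Set.indicator_apply, Set.mem_Iic, Pi.one_apply]
  rcases le_or_gt b z with hbz | hbz
  · rw [if_pos hbz, if_pos (hab.trans hbz)]
    exact steinSolution_sub_bounds_of_le hab hbz
  rw [if_neg (not_le.2 hbz), add_zero]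
  rcases le_or_gt a z with haz | haz
  · rw [if_pos haz]
    have h1 := steinSolution_sub_bounds_of_le haz le_rfl
    have h2 := steinSolution_sub_bounds_of_ge hbz.le le_rfl
    have m1 := monotone_mul_steinSolution z haz
    have m2 := monotone_mul_steinSolution z hbz.le
    simp only at m1 m2
    constructor <;> nlinarith
  · rw [if_neg (not_le.2 haz), add_zero]
    exact steinSolution_sub_bounds_of_ge hab haz.le

/-! ### Sequences solving the recursion -/

/-- The sum of the first `n` terms of a sequence. -/
noncomputable def partialSum (X : ℕ → ℝ) (n : ℕ) : ℝ := ∑ i ∈ Finset.range n, X i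

theorem partialSum_zero (X : ℕ → ℝ) : partialSum X 0 = 0 := Finset.sum_range_zero X

theorem partialSum_succ (X : ℕ → ℝ) (n : ℕ) : partialSum X (n + 1) = partialSum X n + X n :=
  Finset.sum_range_succ X n

theorem partialSum_one (X : ℕ → ℝ) : partialSum X 1 = X 0 := by
  rw [partialSum_succ, partialSum_zero, zero_add]

/-- The terms `X 0 > ⋯ > X M` of a sequence form a solution of the many-interacting-worlds recursion
with `M + 1` points. Later terms are irrelevant. -/
structure IsMIWSequence (M : ℕ) (X : ℕ → ℝ) : Prop where
  step : ∀ n < M, X (n + 1) = X n - 1 / partialSum X (n + 1)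
  sum_eq_zero : partialSum X (M + 1) = 0
  lt : ∀ n < M, X (n + 1) < X n

theorem sum_Iic_fin_eq_partialSum {M : ℕ} (X : ℕ → ℝ) (k : Fin M) :
    ∑ i ∈ Finset.Iic k, X i = partialSum X (k + 1) := by
  have h : Finset.range ((k : ℕ) + 1) = (Finset.Iic k).map Fin.valEmbedding := by
    rw [Fin.map_valEmbedding_Iic]
    ext i
    simp
  rw [partialSum, h, Finset.sum_map]
  rfl

theorem isMIWSolution_iff {M : ℕ} {X : ℕ → ℝ} :
    IsMIWSolution (M + 1) (fun i : Fin (M + 1) => X i) ↔ IsMIWSequence M X := by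
  constructor
  · intro h
    refine ⟨fun n hn => ?_, ?_, fun n hn => ?_⟩
    · have := h.recursion n (Nat.succ_lt_succ hn)
      rwa [sum_Iic_fin_eq_partialSum X] at this
    · rw [partialSum, Finset.sum_range]
      exact h.zeroMean
    · exact h.strictAnti (a := ⟨n, by omega⟩) (b := ⟨n + 1, by omega⟩) (Nat.lt_succ_self n)
  · intro h
    refine ⟨fun n hn => ?_, ?_, ?_⟩
    · rw [sum_Iic_fin_eq_partialSum X]
      exact h.step n (Nat.lt_of_succ_lt_succ hn)
    · rw [← h.sum_eq_zero, partialSum, Finset.sum_range]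
    · exact Fin.strictAnti_iff_succ_lt.2 fun i => h.lt i i.2

theorem exists_sequence_eq {M : ℕ} (x : Fin M → ℝ) : ∃ X : ℕ → ℝ, x = fun i : Fin M => X i :=
  ⟨fun n => if h : n < M then x ⟨n, h⟩ else 0, by funext i; simp⟩

/-- Summation by parts against the partial sums. -/
theorem sum_mul_eq_sum_partialSum_mul_sub (X f : ℕ → ℝ) (M : ℕ) :
    ∑ i ∈ Finset.range (M + 1), X i * f i =
      ∑ i ∈ Finset.range M, partialSum X (i + 1) * (f i - f (i + 1)) +
        partialSum X (M + 1) * f M := by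
  induction M with
  | zero => simp [partialSum]
  | succ M ih =>
    rw [Finset.sum_range_succ, ih, Finset.sum_range_succ, partialSum_succ X (M + 1)]
    ring

namespace IsMIWSequence

variable {M : ℕ} {X : ℕ → ℝ}

theorem partialSum_pos (h : IsMIWSequence M X) {n : ℕ} (hn : n < M) :
    0 < partialSum X (n + 1) := by
  have h1 := h.step n hn
  have h2 := h.lt n hn
  exact one_div_pos.1 (by linarith)

theorem sub_succ (h : IsMIWSequence M X) {n : ℕ} (hn : n < M) :
    X n - X (n + 1) = 1 / partialSum X (n + 1) := by
  rw [h.step n hn]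
  ring

theorem partialSum_mul_sub (h : IsMIWSequence M X) {n : ℕ} (hn : n < M) :
    partialSum X (n + 1) * (X n - X (n + 1)) = 1 := by
  rw [h.sub_succ hn, mul_one_div_cancel (h.partialSum_pos hn).ne']

/-- The discrete Stein identity for a solution. -/
theorem sum_mul_eq (h : IsMIWSequence M X) (f : ℝ → ℝ) :
    ∑ i ∈ Finset.range (M + 1), X i * f (X i) =
      ∑ i ∈ Finset.range M, partialSum X (i + 1) * (f (X i) - f (X (i + 1))) := by
  rw [sum_mul_eq_sum_partialSum_mul_sub X (fun i => f (X i)), h.sum_eq_zero]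
  ring

theorem sum_sq (h : IsMIWSequence M X) : ∑ i ∈ Finset.range (M + 1), X i ^ 2 = M := by
  simp_rw [pow_two]
  rw [h.sum_mul_eq fun t => t,
    Finset.sum_congr rfl fun i hi => h.partialSum_mul_sub (Finset.mem_range.1 hi)]
  simp

theorem anti (h : IsMIWSequence M X) {i j : ℕ} (hij : i ≤ j) (hj : j ≤ M) : X j ≤ X i := by
  induction j, hij using Nat.le_induction with
  | base => exact le_rfl
  | succ j _ ih => exact (h.lt j hj).le.trans (ih (by omega))

theorem partialSum_reflect (h : IsMIWSequence M X) {n : ℕ} (hn : n ≤ M + 1) :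
    partialSum (fun i => -X (M - i)) n = partialSum X (M + 1 - n) := by
  induction n with
  | zero => rw [partialSum_zero, Nat.sub_zero, h.sum_eq_zero]
  | succ n ih =>
    rw [partialSum_succ, ih (by omega), show M + 1 - n = M - n + 1 by omega, partialSum_succ,
      show M + 1 - (n + 1) = M - n by omega]
    ring

theorem reflect (h : IsMIWSequence M X) : IsMIWSequence M fun i => -X (M - i) := by
  refine ⟨fun n hn => ?_, ?_, fun n hn => ?_⟩
  · rw [h.partialSum_reflect (by omega)]
    have := h.step (M - (n + 1)) (by omega)
    rw [show M - (n + 1) + 1 = M - n by omega] at this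
    rw [show M + 1 - (n + 1) = M - n by omega]
    linarith
  · rw [h.partialSum_reflect le_rfl, Nat.sub_self, partialSum_zero]
  · have := h.lt (M - (n + 1)) (by omega)
    rw [show M - (n + 1) + 1 = M - n by omega] at this
    linarith

/-- Points and partial sums depend strictly monotonically on the starting point, so that the last
partial sum cannot vanish for two different starting points. -/
theorem first_not_lt {Y : ℕ → ℝ} (h : IsMIWSequence M X) (h' : IsMIWSequence M Y) : ¬X 0 < Y 0 := by
  intro h0
  have key : ∀ n ≤ M, X n < Y n ∧ partialSum X (n + 1) < partialSum Y (n + 1) := by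
    intro n
    induction n with
    | zero => intro _; simpa only [zero_add, partialSum_one, and_self] using h0
    | succ n ih =>
      intro hn
      obtain ⟨h1, h2⟩ := ih (by omega)
      have h3 : X (n + 1) < Y (n + 1) := by
        rw [h.step n hn, h'.step n hn]
        have := one_div_lt_one_div_of_lt (h.partialSum_pos hn) h2
        linarith
      rw [partialSum_succ X (n + 1), partialSum_succ Y (n + 1)]
      exact ⟨h3, add_lt_add h2 h3⟩
  have := (key M le_rfl).2
  rw [h.sum_eq_zero, h'.sum_eq_zero] at this
  exact lt_irrefl _ this

theorem unique {Y : ℕ → ℝ} (h : IsMIWSequence M X) (h' : IsMIWSequence M Y) {n : ℕ} (hn : n ≤ M) :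
    X n = Y n := by
  have h0 : X 0 = Y 0 := le_antisymm (not_lt.1 (h'.first_not_lt h)) (not_lt.1 (h.first_not_lt h'))
  have key : ∀ n ≤ M, X n = Y n ∧ partialSum X (n + 1) = partialSum Y (n + 1) := by
    intro n
    induction n with
    | zero => intro _; simpa only [zero_add, partialSum_one, and_self] using h0
    | succ n ih =>
      intro hn
      obtain ⟨h1, h2⟩ := ih (by omega)
      have h3 : X (n + 1) = Y (n + 1) := by rw [h.step n hn, h'.step n hn, h1, h2]
      rw [partialSum_succ X (n + 1), partialSum_succ Y (n + 1), h2, h3]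
      exact ⟨rfl, rfl⟩
  exact (key n hn).1

theorem symm (h : IsMIWSequence M X) {n : ℕ} (hn : n ≤ M) : X (M - n) = -X n := by
  rw [h.unique h.reflect hn, neg_neg]

theorem partialSum_symm (h : IsMIWSequence M X) {n : ℕ} (hn : n ≤ M + 1) :
    partialSum X (M + 1 - n) = partialSum X n := by
  rw [← h.partialSum_reflect hn, partialSum, partialSum]
  exact Finset.sum_congr rfl fun i hi =>
    (h.unique h.reflect (by have := Finset.mem_range.1 hi; omega)).symm

end IsMIWSequence

/-! ### Existence by shooting -/

/-- The `n`-th point and the sum of the points up to it, for the recursion started at `c`. -/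
noncomputable def shoot : ℕ → ℝ → ℝ × ℝ
  | 0, c => (c, c)
  | n + 1, c => ((shoot n c).1 - 1 / (shoot n c).2,
      (shoot n c).2 + ((shoot n c).1 - 1 / (shoot n c).2))

theorem partialSum_shoot (c : ℝ) (n : ℕ) :
    partialSum (fun i => (shoot i c).1) (n + 1) = (shoot n c).2 := by
  induction n with
  | zero => rw [zero_add, partialSum_one]; rfl
  | succ n ih => rw [partialSum_succ, ih]; rfl

theorem shoot_lt_shoot {a b : ℝ} (hab : a < b) {n : ℕ} (hpos : ∀ k < n, 0 < (shoot k a).2) :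
    (shoot n a).1 < (shoot n b).1 ∧ (shoot n a).2 < (shoot n b).2 := by
  induction n with
  | zero => exact ⟨hab, hab⟩
  | succ n ih =>
    obtain ⟨h1, h2⟩ := ih fun k hk => hpos k (by omega)
    have h3 := one_div_lt_one_div_of_lt (hpos n (Nat.lt_succ_self n)) h2
    simp only [shoot]
    constructor <;> linarith

theorem continuousAt_shoot {a : ℝ} {n : ℕ} (hpos : ∀ k < n, 0 < (shoot k a).2) :
    ContinuousAt (shoot n) a := by
  induction n with
  | zero => exact continuousAt_id.prodMk continuousAt_id
  | succ n ih =>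
    have h := ih fun k hk => hpos k (by omega)
    have h1 : ContinuousAt (fun c => (shoot n c).1) a := h.fst
    have h2 : ContinuousAt (fun c => (shoot n c).2) a := h.snd
    have h3 : ContinuousAt (fun c => (shoot n c).1 - 1 / (shoot n c).2) a :=
      h1.sub (continuousAt_const.div h2 (hpos n (Nat.lt_succ_self n)).ne')
    exact h3.prodMk (h2.add h3)

theorem one_le_shoot {c : ℝ} {n : ℕ} (hc : n + 1 ≤ c) :
    c - n ≤ (shoot n c).1 ∧ 1 ≤ (shoot n c).2 := by
  induction n with
  | zero => simpa [shoot] using hc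
  | succ n ih =>
    push_cast at hc ⊢
    obtain ⟨h1, h2⟩ := ih (by linarith)
    have h3 : 1 / (shoot n c).2 ≤ 1 := by
      rw [div_le_one (by linarith)]
      exact h2
    simp only [shoot]
    constructor <;> linarith

/-- Starting points for which the first `n` partial sums are positive and the next one vanishes.
The next root lies above the current one: just above a root of the `n`-th partial sum the step
`1 / (shoot n c).2` is huge, so that the following partial sum is negative there. -/
theorem exists_shoot_eq_zero (n : ℕ) :
    ∃ a, (∀ k < n, 0 < (shoot k a).2) ∧ (shoot n a).2 = 0 := by
  induction n with
  | zero => exact ⟨0, fun k hk => absurd hk (Nat.not_lt_zero k), rfl⟩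
  | succ n ih =>
    obtain ⟨a, hpos, ha⟩ := ih
    have hpos' : ∀ t, a < t → ∀ k < n + 1, 0 < (shoot k t).2 := by
      intro t hat k hk
      have h1 := (shoot_lt_shoot hat (n := k) fun j hj => hpos j (by omega)).2
      rcases (Nat.lt_succ_iff_lt_or_eq.1 hk) with hk | rfl
      · exact (hpos k hk).trans h1
      · rwa [ha] at h1
    have hc := continuousAt_shoot hpos
    have hc1 : ContinuousAt (fun c => (shoot n c).1) a := hc.fst
    have hc2 : ContinuousAt (fun c => (shoot n c).2) a := hc.snd
    have hlim : ContinuousAt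
        (fun c => (shoot n c).2 * (shoot n c).2 + (shoot n c).1 * (shoot n c).2) a :=
      (hc2.mul hc2).add (hc1.mul hc2)
    have hev := hlim.tendsto.eventually_lt_const (u := 1) (by rw [ha]; norm_num)
    obtain ⟨c, hc3, hac⟩ := ((hev.filter_mono nhdsWithin_le_nhds).and
      (self_mem_nhdsWithin (s := Set.Ioi a))).exists
    have hS := hpos' c hac n (Nat.lt_succ_self n)
    have hneg : (shoot (n + 1) c).2 ≤ 0 := by
      have h1 : (shoot n c).2 + (shoot n c).1 ≤ 1 / (shoot n c).2 := by
        rw [le_div_iff₀ hS]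
        linarith
      simp only [shoot]
      linarith
    have hb := (one_le_shoot (c := max c (n + 2)) (n := n + 1)
      (by push_cast; linarith [le_max_right c (n + 2 : ℝ)])).2
    obtain ⟨t, ht, ht0⟩ := intermediate_value_Icc (le_max_left c (n + 2 : ℝ))
      (f := fun c => (shoot (n + 1) c).2)
      (fun t ht => (continuousAt_shoot (hpos' t (lt_of_lt_of_le hac ht.1))).snd.continuousWithinAt)
      (show (0 : ℝ) ∈ _ from ⟨hneg, by linarith⟩)
    exact ⟨t, hpos' t (lt_of_lt_of_le hac ht.1), ht0⟩

theorem exists_isMIWSequence (M : ℕ) : ∃ X, IsMIWSequence M X := by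
  obtain ⟨a, hpos, ha⟩ := exists_shoot_eq_zero M
  refine ⟨fun i => (shoot i a).1, fun n _ => ?_, ?_, fun n hn => ?_⟩
  · rw [partialSum_shoot]
    rfl
  · rw [partialSum_shoot, ha]
  · have := one_div_pos.2 (hpos n hn)
    simp only [shoot]
    linarith

theorem existsUnique_isMIWSolution (M : ℕ) : ∃! x : Fin (M + 1) → ℝ, IsMIWSolution (M + 1) x := by
  obtain ⟨X, hX⟩ := exists_isMIWSequence M
  refine ⟨fun i : Fin (M + 1) => X i, isMIWSolution_iff.2 hX, fun y hy => ?_⟩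
  obtain ⟨Y, rfl⟩ := exists_sequence_eq y
  funext i
  exact (isMIWSolution_iff.1 hy).unique hX (Nat.lt_succ_iff.1 i.2)

/-! ### Size of the extreme point and of the partial sums -/

namespace IsMIWSequence

variable {M : ℕ} {X : ℕ → ℝ}

theorem first_pos (h : IsMIWSequence M X) (hM : 0 < M) : 0 < X 0 := by
  rw [← partialSum_one X]
  exact h.partialSum_pos hM

theorem last_eq (h : IsMIWSequence M X) : X M = -X 0 := h.symm (Nat.zero_le M)

theorem abs_le_first (h : IsMIWSequence M X) {i : ℕ} (hi : i ≤ M) : |X i| ≤ X 0 :=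
  abs_le.2 ⟨h.last_eq ▸ h.anti hi le_rfl, h.anti (Nat.zero_le i) hi⟩

theorem half_le_first_sq (h : IsMIWSequence M X) (hM : 0 < M) : 1 / 2 ≤ X 0 ^ 2 := by
  have h1 : ∑ i ∈ Finset.range (M + 1), X i ^ 2 ≤ ∑ _i ∈ Finset.range (M + 1), X 0 ^ 2 :=
    Finset.sum_le_sum fun i hi => sq_le_sq' (h.last_eq ▸ h.anti
      (Nat.lt_succ_iff.1 (Finset.mem_range.1 hi)) le_rfl)
      (h.anti (Nat.zero_le i) (Nat.lt_succ_iff.1 (Finset.mem_range.1 hi)))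
  rw [h.sum_sq, Finset.sum_const, Finset.card_range, nsmul_eq_mul] at h1
  push_cast at h1
  have h2 : (1 : ℝ) ≤ M := by exact_mod_cast hM
  by_contra! hlt
  nlinarith

theorem partialSum_le (h : IsMIWSequence M X) {n : ℕ} (hn : n ≤ M + 1) :
    partialSum X n ≤ M + 1 := by
  have h1 : partialSum X n ≤ ∑ i ∈ Finset.range n, (1 + X i ^ 2) / 2 :=
    Finset.sum_le_sum fun i _ => by nlinarith [sq_nonneg (X i - 1)]
  have h2 : ∑ i ∈ Finset.range n, (1 + X i ^ 2) / 2 ≤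
      ∑ i ∈ Finset.range (M + 1), (1 + X i ^ 2) / 2 :=
    Finset.sum_le_sum_of_subset_of_nonneg (Finset.range_mono hn) fun i _ _ => by positivity
  rw [← Finset.sum_div (Finset.range (M + 1)), Finset.sum_add_distrib, h.sum_sq] at h2
  simp only [Finset.sum_const, Finset.card_range, nsmul_eq_mul, mul_one] at h2
  push_cast at h2
  linarith

/-- Along a solution the quantity `X i ^ 2 + 2 log (X 0 + ⋯ + X i)` decreases. -/
theorem sq_add_log_anti (h : IsMIWSequence M X) {i j : ℕ} (hij : i ≤ j) (hj : j < M) :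
    X j ^ 2 + 2 * Real.log (partialSum X (j + 1)) ≤
      X i ^ 2 + 2 * Real.log (partialSum X (i + 1)) := by
  induction j, hij using Nat.le_induction with
  | base => exact le_rfl
  | succ j _ ih =>
    refine le_trans ?_ (ih (by omega))
    have hS := h.partialSum_pos (n := j) (by omega)
    have hS' := h.partialSum_pos hj
    have hg : X j = X (j + 1) + 1 / partialSum X (j + 1) := by
      rw [h.step j (by omega)]
      ring
    have hlog := Real.log_le_sub_one_of_pos (div_pos hS' hS)
    rw [Real.log_div hS'.ne' hS.ne'] at hlog
    have he : partialSum X (j + 1 + 1) / partialSum X (j + 1) - 1 =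
        X (j + 1) * (1 / partialSum X (j + 1)) := by
      rw [partialSum_succ X (j + 1)]
      field_simp
      ring
    rw [he] at hlog
    rw [hg]
    nlinarith [sq_nonneg (1 / partialSum X (j + 1))]

/-- Along a solution the quantity `X i ^ 2 + 2 log (X 0 + ⋯ + X (i - 1))` increases. -/
theorem sq_add_log_mono (h : IsMIWSequence M X) {i j : ℕ} (hij : i ≤ j) (hj : j < M) :
    X (i + 1) ^ 2 + 2 * Real.log (partialSum X (i + 1)) ≤
      X (j + 1) ^ 2 + 2 * Real.log (partialSum X (j + 1)) := by
  induction j, hij using Nat.le_induction with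
  | base => exact le_rfl
  | succ j _ ih =>
    refine (ih (by omega)).trans ?_
    have hS := h.partialSum_pos (n := j) (by omega)
    have hS' := h.partialSum_pos hj
    have hg : X (j + 1 + 1) = X (j + 1) - 1 / partialSum X (j + 1 + 1) := h.step (j + 1) hj
    have hlog := Real.log_le_sub_one_of_pos (div_pos hS hS')
    rw [Real.log_div hS.ne' hS'.ne'] at hlog
    have he : partialSum X (j + 1) / partialSum X (j + 1 + 1) - 1 =
        -X (j + 1) * (1 / partialSum X (j + 1 + 1)) := by
      have : partialSum X (j + 1) = partialSum X (j + 1 + 1) - X (j + 1) := by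
        rw [partialSum_succ X (j + 1)]
        ring
      rw [this]
      field_simp
      ring
    rw [he] at hlog
    rw [hg]
    nlinarith [sq_nonneg (1 / partialSum X (j + 1 + 1))]

theorem first_sq_le (h : IsMIWSequence M X) (hM : 0 < M) :
    X 0 ^ 2 ≤ 3 + 2 * Real.log (M + 1) := by
  have hlogM : 0 ≤ Real.log (M + 1) := Real.log_nonneg (by linarith [M.cast_nonneg (α := ℝ)])
  have hX0 := h.first_pos hM
  rcases le_or_gt (X 0) 1 with h01 | h01
  · nlinarith
  -- the mean of `X i ^ 2` is `M / (M + 1)`, hence one of these squares is below `1`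
  obtain ⟨j, hj, hj1⟩ : ∃ j ∈ Finset.range (M + 1), X j ^ 2 ≤ 1 := by
    by_contra! hcon
    have := Finset.sum_lt_sum_of_nonempty (by simp) hcon
    rw [h.sum_sq] at this
    simp at this
    linarith
  rw [Finset.mem_range] at hj
  rcases j with _ | j
  · linarith
  have h1 := h.sq_add_log_mono (Nat.zero_le j) (by omega)
  rw [zero_add, partialSum_one, h.step 0 hM, zero_add, partialSum_one] at h1
  have h2 : 0 ≤ Real.log (X 0) := Real.log_nonneg h01.le
  have h3 : Real.log (partialSum X (j + 1)) ≤ Real.log (M + 1) :=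
    Real.log_le_log (h.partialSum_pos (by omega)) (h.partialSum_le (by omega))
  have h4 : X 0 ^ 2 - 2 ≤ (X 0 - 1 / X 0) ^ 2 := by
    have : (X 0 - 1 / X 0) ^ 2 = X 0 ^ 2 - 2 + (1 / X 0) ^ 2 := by
      field_simp
      ring
    rw [this]
    linarith [sq_nonneg (1 / X 0)]
  linarith

/-- The range `2 * X 0` of a solution is covered by `M` gaps, so that one of them is short. -/
theorem exists_le_two_mul_first_mul_partialSum (h : IsMIWSequence M X) (hM : 0 < M) :
    ∃ p < M, (M : ℝ) ≤ 2 * X 0 * partialSum X (p + 1) := by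
  have hX0 := h.first_pos hM
  by_contra! hcon
  have h1 : ∑ i ∈ Finset.range M, (2 * X 0) < ∑ i ∈ Finset.range M, M * (X i - X (i + 1)) := by
    refine Finset.sum_lt_sum_of_nonempty (Finset.nonempty_range_iff.2 hM.ne') fun i hi => ?_
    have hi := Finset.mem_range.1 hi
    rw [h.sub_succ hi, mul_one_div, lt_div_iff₀ (h.partialSum_pos hi)]
    exact hcon i hi
  rw [← Finset.mul_sum _ _ (M : ℝ), Finset.sum_range_sub', h.last_eq, Finset.sum_const, Finset.card_range,
    nsmul_eq_mul] at h1
  linarith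

/-- Partial sums of a decreasing symmetric sequence are smallest at the ends. -/
theorem partialSum_le_partialSum (h : IsMIWSequence M X) {m n : ℕ} (hmn : m ≤ n)
    (hn : n + m ≤ M + 1) : partialSum X m ≤ partialSum X n := by
  rcases hmn.eq_or_lt with rfl | hlt
  · exact le_rfl
  rcases le_or_gt 0 (X (n - 1)) with hx | hx
  · rw [partialSum, partialSum, ← Finset.sum_range_add_sum_Ico X hmn]
    refine le_add_of_nonneg_right (Finset.sum_nonneg fun i hi => hx.trans ?_)
    have := Finset.mem_Ico.1 hi
    exact h.anti (by omega) (by omega)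
  · rw [← h.partialSum_symm (n := m) (by omega), partialSum, partialSum,
      ← Finset.sum_range_add_sum_Ico X (show n ≤ M + 1 - m by omega)]
    refine add_le_of_nonpos_right (Finset.sum_nonpos fun i hi => le_trans ?_ hx.le)
    have := Finset.mem_Ico.1 hi
    exact h.anti (by omega) (by omega)

end IsMIWSequence

/-! ### Integration against the empirical distribution -/

theorem integral_empiricalDistribution (M : ℕ) (X f : ℕ → ℝ) (g : ℝ → ℝ)
    (hf : ∀ i ≤ M, g (X i) = f i) :
    ∫ t, g t ∂empiricalDistribution (fun i : Fin (M + 1) => X i) =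
      (∑ i ∈ Finset.range (M + 1), f i) / (M + 1) := by
  rw [empiricalDistribution, integral_smul_measure,
    integral_finsetSum_measure fun i _ => integrable_dirac enorm_lt_top]
  simp only [integral_dirac]
  rw [Finset.sum_range, Finset.sum_congr rfl fun (i : Fin (M + 1)) _ =>
    hf i (Nat.lt_succ_iff.1 i.2)]
  rw [ENNReal.toReal_inv, ENNReal.toReal_natCast, smul_eq_mul, div_eq_inv_mul, Nat.cast_succ]

instance isProbabilityMeasure_empiricalDistribution {N : ℕ} (x : Fin (N + 1) → ℝ) :
    IsProbabilityMeasure (empiricalDistribution x) := by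
  constructor
  rw [empiricalDistribution_apply x MeasurableSet.univ]
  simp [ENNReal.div_self]

theorem empiricalDistribution_real_Iic (M : ℕ) (X : ℕ → ℝ) (z : ℝ) :
    (empiricalDistribution (fun i : Fin (M + 1) => X i)).real (Set.Iic z) =
      (∑ i ∈ Finset.range (M + 1), (Set.Iic z).indicator 1 (X i)) / (M + 1) := by
  rw [← integral_indicator_one measurableSet_Iic]
  exact integral_empiricalDistribution M X _ _ fun i _ => rfl

/-! ### Kolmogorov distance -/

theorem indicator_Iic_one_mem_Icc (z t : ℝ) :
    (Set.Iic z).indicator (1 : ℝ → ℝ) t ∈ Set.Icc (0 : ℝ) 1 := by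
  by_cases h : t ∈ Set.Iic z <;> simp [h]

namespace IsMIWSequence

variable {M : ℕ} {X : ℕ → ℝ}

/-- Stein's method for half-lines. In the discrete Stein identity each difference of the Stein
solution is bounded by endpoint values, and the resulting sums telescope. -/
theorem abs_sum_indicator_sub_le (h : IsMIWSequence M X) (z : ℝ) :
    |∑ i ∈ Finset.range (M + 1), ((Set.Iic z).indicator 1 (X i) - stdNormalCDF z)| ≤ 1 := by
  set g : ℕ → ℝ := fun i => X i * steinSolution z (X i) with hg
  set e : ℕ → ℝ := fun i => (Set.Iic z).indicator 1 (X i) with he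
  have hid := h.sum_mul_eq (steinSolution z)
  have hup : ∑ i ∈ Finset.range (M + 1), g i ≤
      ∑ i ∈ Finset.range M, (g i + (e (i + 1) - stdNormalCDF z)) := by
    rw [hg, hid]
    refine Finset.sum_le_sum fun i hi => ?_
    have hi := Finset.mem_range.1 hi
    have h1 := mul_le_mul_of_nonneg_left (steinSolution_sub_bounds (z := z) (h.lt i hi).le).2
      (h.partialSum_pos hi).le
    rw [← mul_assoc, h.partialSum_mul_sub hi, one_mul, add_sub_assoc] at h1
    exact h1
  have hlow : ∑ i ∈ Finset.range M, (g (i + 1) + (e i - stdNormalCDF z)) ≤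
      ∑ i ∈ Finset.range (M + 1), g i := by
    rw [hg, hid]
    refine Finset.sum_le_sum fun i hi => ?_
    have hi := Finset.mem_range.1 hi
    have h1 := mul_le_mul_of_nonneg_left (steinSolution_sub_bounds (z := z) (h.lt i hi).le).1
      (h.partialSum_pos hi).le
    rw [← mul_assoc, h.partialSum_mul_sub hi, one_mul, add_sub_assoc] at h1
    exact h1
  rw [Finset.sum_add_distrib, Finset.sum_range_succ] at hup
  rw [Finset.sum_add_distrib, Finset.sum_range_succ'] at hlow
  have b1 : stdNormalCDF z - 1 ≤ g M := stdNormalCDF_sub_one_le_mul_steinSolution z (X M)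
  have b2 : g 0 ≤ stdNormalCDF z := mul_steinSolution_le z (X 0)
  have c1 : 0 ≤ e 0 := (indicator_Iic_one_mem_Icc z (X 0)).1
  have c2 : e M ≤ 1 := (indicator_Iic_one_mem_Icc z (X M)).2
  rw [abs_le]
  constructor
  · rw [Finset.sum_range_succ']
    linarith
  · rw [Finset.sum_range_succ]
    linarith

theorem abs_real_Iic_sub_le (h : IsMIWSequence M X) (z : ℝ) :
    |(empiricalDistribution (fun i : Fin (M + 1) => X i)).real (Set.Iic z) - stdNormalCDF z| ≤
      1 / (M + 1) := by
  have hM : (0 : ℝ) < M + 1 := by positivity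
  have h1 := h.abs_sum_indicator_sub_le z
  rw [Finset.sum_sub_distrib, Finset.sum_const, Finset.card_range, nsmul_eq_mul] at h1
  rw [empiricalDistribution_real_Iic, ← mul_div_cancel_left₀ (stdNormalCDF z) hM.ne', ← sub_div,
    abs_div, abs_of_pos hM]
  push_cast at h1
  gcongr

theorem kolmogorovDist_le (h : IsMIWSequence M X) :
    kolmogorovDist (empiricalDistribution (fun i : Fin (M + 1) => X i)) (gaussianReal 0 1) ≤
      ENNReal.ofReal (1 / (M + 1)) :=
  iSup_le fun z => ENNReal.ofReal_le_ofReal (h.abs_real_Iic_sub_le z)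

theorem real_Iic_first (h : IsMIWSequence M X) :
    (empiricalDistribution (fun i : Fin (M + 1) => X i)).real (Set.Iic (X 0)) = 1 := by
  rw [empiricalDistribution_real_Iic, Finset.sum_congr rfl fun i hi =>
    Set.indicator_of_mem (Set.mem_Iic.2 (h.anti (Nat.zero_le i)
      (Nat.lt_succ_iff.1 (Finset.mem_range.1 hi)))) 1]
  have hM : (M : ℝ) + 1 ≠ 0 := by positivity
  simp [hM]

end IsMIWSequence

theorem empiricalDistribution_real_Iic_le_of_lt {M : ℕ} {X : ℕ → ℝ} {z : ℝ} (hz : z < X 0) :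
    (empiricalDistribution (fun i : Fin (M + 1) => X i)).real (Set.Iic z) ≤ M / (M + 1) := by
  rw [empiricalDistribution_real_Iic, Finset.sum_range_succ']
  gcongr
  rw [Set.indicator_of_notMem (by simpa using hz), add_zero]
  refine (Finset.sum_le_sum fun i _ => (indicator_Iic_one_mem_Icc z (X (i + 1))).2).trans ?_
  simp

/-- The empirical distribution function jumps by at least `1 / (M + 1)` at the largest point, where
the normal distribution function is continuous. -/
theorem IsMIWSequence.le_kolmogorovDist {M : ℕ} {X : ℕ → ℝ} (h : IsMIWSequence M X) :
    ENNReal.ofReal (1 / (2 * (M + 1))) ≤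
      kolmogorovDist (empiricalDistribution (fun i : Fin (M + 1) => X i)) (gaussianReal 0 1) := by
  set μ := empiricalDistribution (fun i : Fin (M + 1) => X i)
  by_contra! hlt
  have hM : (0 : ℝ) < M + 1 := by positivity
  have hz : ∀ z, |μ.real (Set.Iic z) - stdNormalCDF z| < 1 / (2 * (M + 1)) := fun z =>
    (ENNReal.ofReal_lt_ofReal_iff (by positivity)).1 ((le_iSup (fun z : ℝ =>
      ENNReal.ofReal |μ.real (Set.Iic z) - (gaussianReal 0 1).real (Set.Iic z)|) z).trans_lt hlt)
  have h1 := (abs_lt.1 (hz (X 0))).2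
  rw [h.real_Iic_first] at h1
  have hcont : Filter.Tendsto stdNormalCDF (nhdsWithin (X 0) (Set.Iio (X 0)))
      (nhds (stdNormalCDF (X 0))) :=
    (hasDerivAt_stdNormalCDF (X 0)).continuousAt.tendsto.mono_left nhdsWithin_le_nhds
  have h2 : stdNormalCDF (X 0) ≤ M / (M + 1) + 1 / (2 * (M + 1)) := by
    refine le_of_tendsto hcont (eventually_nhdsWithin_of_forall fun z hzX => ?_)
    have h3 := (abs_lt.1 (hz z)).1
    have h4 := empiricalDistribution_real_Iic_le_of_lt (M := M) (X := X) hzX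
    linarith
  have h5 : (M : ℝ) / (M + 1) + 1 / (2 * (M + 1)) + 1 / (2 * (M + 1)) = 1 := by
    field_simp
    ring
  linarith

/-! ### Upper bound for the Wasserstein distance -/

/-- The projection of the real line to `[-b, b]`. -/
noncomputable def clamp (b t : ℝ) : ℝ := max (-b) (min t b)

theorem continuous_clamp (b : ℝ) : Continuous (clamp b) := by
  unfold clamp
  fun_prop

theorem clamp_mem {b : ℝ} (hb : 0 ≤ b) (t : ℝ) : clamp b t ∈ Set.Icc (-b) b :=
  ⟨le_max_left _ _, max_le (by linarith) (min_le_right _ _)⟩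

theorem clamp_of_abs_le {b t : ℝ} (ht : |t| ≤ b) : clamp b t = t := by
  rw [clamp, min_eq_left (abs_le.1 ht).2, max_eq_right (abs_le.1 ht).1]

theorem sub_clamp_abs {b : ℝ} (hb : 0 ≤ b) (t : ℝ) :
    |t - clamp b t| = max (-b - t) 0 + max (-b - -t) 0 := by
  rw [clamp]
  rcases le_total t b with h1 | h1 <;> rcases le_total t (-b) with h2 | h2
  · rw [min_eq_left h1, max_eq_left h2, abs_of_nonpos (by linarith), max_eq_left (by linarith),
      max_eq_right (by linarith)]
    ring
  · rw [min_eq_left h1, max_eq_right h2, max_eq_right (by linarith), max_eq_right (by linarith)]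
    simp
  · rw [min_eq_right h1, max_eq_right (by linarith), abs_of_nonneg (by linarith),
      max_eq_right (by linarith), max_eq_left (by linarith)]
    ring
  · rw [min_eq_right h1, max_eq_right (by linarith), abs_of_nonneg (by linarith),
      max_eq_right (by linarith), max_eq_left (by linarith)]
    ring

theorem integrable_max_sub_gaussianReal (a : ℝ) :
    Integrable (fun t => max (a - t) 0) (gaussianReal 0 1) :=
  ((integrable_const a).sub integrable_id_gaussianReal).pos_part

theorem integral_max_sub_gaussianReal (a : ℝ) :
    ∫ t, max (a - t) 0 ∂gaussianReal 0 1 = a * stdNormalCDF a + stdNormalPDF a := by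
  rw [integral_gaussianReal_eq_integral_smul one_ne_zero, ← integral_Iic_sub_mul_stdNormalPDF,
    ← integral_indicator measurableSet_Iic]
  refine integral_congr_ae (Filter.Eventually.of_forall fun t => ?_)
  simp only [smul_eq_mul, Set.indicator_apply, Set.mem_Iic]
  split_ifs with ht
  · rw [max_eq_left (by linarith), mul_comm]
    rfl
  · rw [max_eq_right (by linarith), mul_zero]

theorem integrable_max_sub_neg_gaussianReal (a : ℝ) :
    Integrable (fun t => max (a - -t) 0) (gaussianReal 0 1) :=
  ((integrable_const a).sub integrable_id_gaussianReal.neg).pos_part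

theorem integral_comp_neg_gaussianReal {f : ℝ → ℝ} (hf : Continuous f) :
    ∫ t, f (-t) ∂gaussianReal 0 1 = ∫ t, f t ∂gaussianReal 0 1 := by
  have h := gaussianReal_map_neg (μ := 0) (v := 1)
  rw [neg_zero] at h
  conv_rhs => rw [← h]
  rw [integral_map measurable_neg.aemeasurable hf.aestronglyMeasurable]

/-- The mean distance of a standard normal variable from `[-b, b]`. -/
theorem integral_abs_sub_clamp_le {b : ℝ} (hb : 0 < b) :
    ∫ t, |t - clamp b t| ∂gaussianReal 0 1 ≤ 2 * ((1 - stdNormalCDF b) / b) := by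
  simp_rw [sub_clamp_abs hb.le]
  rw [integral_add (integrable_max_sub_gaussianReal _) (integrable_max_sub_neg_gaussianReal _),
    integral_comp_neg_gaussianReal (f := fun t => max (-b - t) 0) (by fun_prop),
    integral_max_sub_gaussianReal, ← stdNormalCDF_neg]
  have h := one_add_sq_mul_stdNormalCDF_add_nonneg (-b)
  have h2 : -b * stdNormalCDF (-b) + stdNormalPDF (-b) ≤ stdNormalCDF (-b) / b := by
    rw [le_div_iff₀ hb]
    linarith
  linarith

/-- The mean of a Lipschitz function of a clamped variable in terms of the distribution function:
`h` is the integral of its almost everywhere derivative, and Fubini's theorem applies. -/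
theorem integral_comp_clamp {ν : Measure ℝ} [IsProbabilityMeasure ν] {h : ℝ → ℝ}
    (hh : LipschitzWith 1 h) {b : ℝ} (hb : 0 ≤ b) :
    ∫ t, h (clamp b t) ∂ν = h b - ∫ s in Set.Ioc (-b) b, deriv h s * ν.real (Set.Iic s) := by
  have hle : ∀ s, ‖deriv h s‖ ≤ 1 := fun s => by
    simpa using norm_deriv_le_of_lipschitz (x₀ := s) hh
  have hpt : ∀ t, h (clamp b t) =
      h b - ∫ s in Set.Ioc (-b) b, deriv h s * (Set.Iic s).indicator 1 t := by
    intro t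
    have hc := clamp_mem hb t
    have hac := (hh.lipschitzOnWith (s := Set.uIcc (clamp b t) b)).absolutelyContinuousOnInterval
    have hint := hac.integral_deriv_eq_sub
    have hset : ∀ s, deriv h s * (Set.Iic s).indicator 1 t =
        (Set.Ici t).indicator (deriv h) s := by
      intro s
      by_cases hs : t ≤ s <;> simp [hs]
    simp_rw [hset]
    rw [setIntegral_indicator measurableSet_Ici]
    have hae : (Set.Ioc (-b) b ∩ Set.Ici t : Set ℝ) =ᵐ[volume] Set.Ioc (clamp b t) b := by
      have hsub : (Set.Ioc (-b) b ∩ Set.Ioi t : Set ℝ) = Set.Ioc (clamp b t) b := by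
        ext s
        simp only [clamp, Set.mem_inter_iff, Set.mem_Ioc, Set.mem_Ioi, max_lt_iff, min_lt_iff]
        constructor
        · rintro ⟨⟨h1, h2⟩, h3⟩
          exact ⟨⟨h1, Or.inl h3⟩, h2⟩
        · rintro ⟨⟨h1, h3⟩, h2⟩
          exact ⟨⟨h1, h2⟩, h3.resolve_right (not_lt.2 h2)⟩
      rw [← hsub]
      exact (Filter.EventuallyEq.refl _ _).inter Ioi_ae_eq_Ici.symm
    rw [setIntegral_congr_set hae, ← intervalIntegral.integral_of_le hc.2, hint]
    ring
  have hmeas : Measurable (Function.uncurry fun t s : ℝ =>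
      deriv h s * (Set.Iic s).indicator (1 : ℝ → ℝ) t) := by
    have h1 : Measurable fun p : ℝ × ℝ => deriv h p.2 := (measurable_deriv h).comp measurable_snd
    have h2 : Measurable fun p : ℝ × ℝ => (Set.Iic p.2).indicator (1 : ℝ → ℝ) p.1 := by
      have : (fun p : ℝ × ℝ => (Set.Iic p.2).indicator (1 : ℝ → ℝ) p.1) =
          {p : ℝ × ℝ | p.1 ≤ p.2}.indicator fun _ => 1 := by
        funext p
        simp [Set.indicator_apply]
      rw [this]
      exact measurable_const.indicator (measurableSet_le measurable_fst measurable_snd)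
    exact h1.mul h2
  have hint : Integrable (Function.uncurry fun t s : ℝ =>
      deriv h s * (Set.Iic s).indicator (1 : ℝ → ℝ) t)
      (ν.prod (volume.restrict (Set.Ioc (-b) b))) := by
    refine Integrable.of_bound hmeas.aestronglyMeasurable 1 (Filter.Eventually.of_forall ?_)
    rintro ⟨t, s⟩
    obtain ⟨h0, h1⟩ := indicator_Iic_one_mem_Icc s t
    simp only [Function.uncurry_apply_pair, norm_mul]
    exact mul_le_one₀ (hle s) (norm_nonneg _) (by rwa [Real.norm_of_nonneg h0])
  have hint' : Integrable (fun t => ∫ s in Set.Ioc (-b) b,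
      deriv h s * (Set.Iic s).indicator (1 : ℝ → ℝ) t) ν := hint.integral_prod_left
  simp_rw [hpt]
  rw [integral_sub (integrable_const _) hint', integral_integral_swap hint]
  simp only [integral_const, probReal_univ, one_smul, integral_const_mul,
    integral_indicator_one measurableSet_Iic]

namespace IsMIWSequence

variable {M : ℕ} {X : ℕ → ℝ}

theorem abs_integral_sub_le (h : IsMIWSequence M X) (hM : 0 < M) {f : ℝ → ℝ}
    (hf : LipschitzWith 1 f) :
    |∫ t, f t ∂empiricalDistribution (fun i : Fin (M + 1) => X i) - ∫ t, f t ∂gaussianReal 0 1| ≤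
      (2 * X 0 + 2 / X 0) / (M + 1) := by
  have hb := h.first_pos hM
  have hN : (0 : ℝ) < M + 1 := by positivity
  set μ := empiricalDistribution (fun i : Fin (M + 1) => X i) with hμ
  set b := X 0 with hbdef
  have h1 : ∫ t, f t ∂μ = ∫ t, f (clamp b t) ∂μ := by
    rw [integral_empiricalDistribution M X (fun i => f (X i)) f fun i _ => rfl,
      integral_empiricalDistribution M X (fun i => f (X i)) (fun t => f (clamp b t))
        fun i hi => congrArg f (clamp_of_abs_le (h.abs_le_first hi))]
  have hle : ∀ s, ‖deriv f s‖ ≤ 1 := fun s => by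
    simpa using norm_deriv_le_of_lipschitz (x₀ := s) hf
  have hI : ∀ ν : Measure ℝ, IsProbabilityMeasure ν →
      IntegrableOn (fun s => deriv f s * ν.real (Set.Iic s)) (Set.Ioc (-b) b) := by
    intro ν _
    have hmono : Monotone fun s => ν.real (Set.Iic s) := fun s t hst =>
      measureReal_mono (Set.Iic_subset_Iic.2 hst)
    refine Integrable.of_bound
      ((measurable_deriv f).mul hmono.measurable).aestronglyMeasurable 1
      (Filter.Eventually.of_forall fun s => ?_)
    rw [norm_mul]
    exact mul_le_one₀ (hle s) (norm_nonneg _)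
      (by rw [Real.norm_of_nonneg measureReal_nonneg]; exact measureReal_le_one)
  -- inside `[-b, b]` the distribution functions are compared
  have h2 : |∫ t, f (clamp b t) ∂μ - ∫ t, f (clamp b t) ∂gaussianReal 0 1| ≤
      2 * b / (M + 1) := by
    rw [integral_comp_clamp hf hb.le, integral_comp_clamp hf hb.le, sub_sub_sub_cancel_left,
      ← integral_sub (hI _ inferInstance) (hI _ inferInstance), ← Real.norm_eq_abs]
    have h3 := norm_setIntegral_le_of_norm_le_const (μ := volume) (s := Set.Ioc (-b) b)
      (f := fun s => deriv f s * (gaussianReal 0 1).real (Set.Iic s) -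
        deriv f s * μ.real (Set.Iic s)) (C := 1 / (M + 1)) (by simp) fun s _ => by
        rw [← mul_sub, norm_mul, Real.norm_eq_abs (_ - _), abs_sub_comm]
        calc ‖deriv f s‖ * |μ.real (Set.Iic s) - (gaussianReal 0 1).real (Set.Iic s)|
            ≤ 1 * (1 / (M + 1)) := by
              gcongr
              · exact hle s
              · exact h.abs_real_Iic_sub_le s
          _ = 1 / (M + 1) := one_mul _
    refine h3.trans (le_of_eq ?_)
    rw [Real.volume_real_Ioc_of_le (by linarith)]
    ring
  have hcl : ∀ t, ‖f (clamp b t) - f t‖ ≤ |t - clamp b t| := fun t => by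
    have := hf.dist_le_mul (clamp b t) t
    rw [Real.dist_eq, Real.dist_eq, NNReal.coe_one, one_mul, abs_sub_comm (clamp b t)] at this
    exact this
  have hIabs : Integrable (fun t => |t - clamp b t|) (gaussianReal 0 1) := by
    simp_rw [sub_clamp_abs hb.le]
    exact (integrable_max_sub_gaussianReal _).add (integrable_max_sub_neg_gaussianReal _)
  have hIf : Integrable f (gaussianReal 0 1) := by
    refine Integrable.mono' ((integrable_const |f 0|).add integrable_id_gaussianReal.abs)
      hf.continuous.aestronglyMeasurable (Filter.Eventually.of_forall fun t => ?_)
    have := hf.dist_le_mul t 0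
    rw [Real.dist_eq, Real.dist_eq, NNReal.coe_one, one_mul, sub_zero] at this
    have h4 := abs_sub_abs_le_abs_sub (f t) (f 0)
    simp only [Pi.add_apply, Real.norm_eq_abs]
    linarith
  have hIfc : Integrable (fun t => f (clamp b t)) (gaussianReal 0 1) := by
    have hd : Integrable (fun t => f (clamp b t) - f t) (gaussianReal 0 1) :=
      hIabs.mono' ((hf.continuous.comp (continuous_clamp b)).sub
        hf.continuous).aestronglyMeasurable (Filter.Eventually.of_forall hcl)
    refine (hd.add hIf).congr (Filter.Eventually.of_forall fun t => ?_)
    simp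
  -- outside `[-b, b]` there is only the normal tail, whose mass beyond `b` is at most `1 / (M + 1)`
  have h5 : |∫ t, f (clamp b t) ∂gaussianReal 0 1 - ∫ t, f t ∂gaussianReal 0 1| ≤
      2 / b / (M + 1) := by
    rw [← integral_sub hIfc hIf, ← Real.norm_eq_abs]
    refine (norm_integral_le_of_norm_le hIabs (Filter.Eventually.of_forall hcl)).trans
      ((integral_abs_sub_clamp_le hb).trans ?_)
    have h6 := (abs_le.1 (h.abs_real_Iic_sub_le b)).2
    rw [h.real_Iic_first] at h6
    calc 2 * ((1 - stdNormalCDF b) / b) ≤ 2 * (1 / (M + 1) / b) := by gcongr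
      _ = 2 / b / (M + 1) := by ring
  rw [h1, add_div]
  exact (abs_sub_le _ _ _).trans (add_le_add h2 h5)

theorem wassersteinDist_le (h : IsMIWSequence M X) (hM : 0 < M) :
    wassersteinDist (empiricalDistribution (fun i : Fin (M + 1) => X i)) (gaussianReal 0 1) ≤
      ENNReal.ofReal (16 * √(Real.log (M + 1)) / (M + 1)) := by
  refine iSup₂_le fun f hf => ENNReal.ofReal_le_ofReal ((h.abs_integral_sub_le hM hf).trans ?_)
  gcongr
  have hb := h.first_pos hM
  have hM1 : (2 : ℝ) ≤ M + 1 := by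
    have : (1 : ℝ) ≤ M := by exact_mod_cast hM
    linarith
  have hlog : (0.69 : ℝ) ≤ Real.log (M + 1) := by
    have h1 := Real.log_le_log (by norm_num) hM1
    have h2 := Real.log_two_gt_d9
    linarith
  have hs := Real.sq_sqrt (show (0 : ℝ) ≤ Real.log (M + 1) by linarith)
  have hs0 := Real.sqrt_nonneg (Real.log (M + 1))
  set s := √(Real.log (M + 1))
  have h1 := h.half_le_first_sq hM
  have h2 := h.first_sq_le hM
  have h3 : X 0 ≤ 2.7 * s := abs_le_of_sq_le_sq' (by nlinarith) (by positivity) |>.2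
  have h4 : 0.8 ≤ s := by nlinarith
  have h5 : 2 / X 0 ≤ 3 := by
    rw [div_le_iff₀ hb]
    nlinarith
  linarith

end IsMIWSequence

/-! ### Lower bound for the Wasserstein distance -/

/-- A function above the tent over `[a, b]` has at least the integral of the tent. -/
theorem sq_div_four_le_integral_of_tent_le {k : ℝ → ℝ} (hk : Continuous k) {a b : ℝ} (hab : a ≤ b)
    (h : ∀ t ∈ Set.Icc a b, min (t - a) (b - t) ≤ k t) : (b - a) ^ 2 / 4 ≤ ∫ t in a..b, k t := by
  have h1 : ∫ t in a..(a + b) / 2, (t - a) ≤ ∫ t in a..(a + b) / 2, k t := by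
    refine intervalIntegral.integral_mono_on (by linarith)
      (Continuous.intervalIntegrable (by fun_prop) _ _) (hk.intervalIntegrable _ _) fun t ht => ?_
    refine le_trans ?_ (h t ⟨ht.1, by linarith [ht.2]⟩)
    rw [min_eq_left (by linarith [ht.2])]
  have h2 : ∫ t in (a + b) / 2..b, (b - t) ≤ ∫ t in (a + b) / 2..b, k t := by
    refine intervalIntegral.integral_mono_on (by linarith)
      (Continuous.intervalIntegrable (by fun_prop) _ _) (hk.intervalIntegrable _ _) fun t ht => ?_
    refine le_trans ?_ (h t ⟨by linarith [ht.1], ht.2⟩)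
    rw [min_eq_right (by linarith [ht.1])]
  rw [← intervalIntegral.integral_add_adjacent_intervals (hk.intervalIntegrable a ((a + b) / 2))
    (hk.intervalIntegrable ((a + b) / 2) b)]
  rw [intervalIntegral.integral_sub (Continuous.intervalIntegrable (by fun_prop) _ _)
    (Continuous.intervalIntegrable (by fun_prop) _ _), integral_id,
    intervalIntegral.integral_const, smul_eq_mul] at h1 h2
  linarith

/-- Stein's identity for the standard normal distribution. -/
theorem integral_deriv_sub_mul_gaussianReal {F k : ℝ → ℝ} (hF : ∀ w, HasDerivAt F (k w) w)
    (hk : Continuous k) {A B : ℝ} (hFb : ∀ w, |F w| ≤ A) (hkb : ∀ w, |k w| ≤ B) :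
    ∫ w, (k w - w * F w) ∂gaussianReal 0 1 = 0 := by
  have hFc : Continuous F := continuous_iff_continuousAt.2 fun w => (hF w).continuousAt
  have h1 : Integrable fun w => F w * stdNormalPDF w :=
    integrable_stdNormalPDF.bdd_mul hFc.aestronglyMeasurable (Filter.Eventually.of_forall hFb)
  have h2 : Integrable fun w => k w * stdNormalPDF w :=
    integrable_stdNormalPDF.bdd_mul hk.aestronglyMeasurable (Filter.Eventually.of_forall hkb)
  have h3 : Integrable fun w => F w * (w * stdNormalPDF w) :=
    integrable_mul_stdNormalPDF.bdd_mul hFc.aestronglyMeasurable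
      (Filter.Eventually.of_forall hFb)
  have hd : ∀ w, HasDerivAt (fun w => F w * stdNormalPDF w)
      (k w * stdNormalPDF w - F w * (w * stdNormalPDF w)) w := fun w =>
    ((hF w).mul (hasDerivAt_stdNormalPDF w)).congr_deriv (by ring)
  rw [integral_gaussianReal_eq_integral_smul one_ne_zero]
  refine Eq.trans ?_ (integral_eq_zero_of_hasDerivAt_of_integrable hd (h2.sub h3) h1)
  refine integral_congr_ae (Filter.Eventually.of_forall fun w => ?_)
  simp only [smul_eq_mul, stdNormalPDF]
  ring

namespace IsMIWSequence

variable {M : ℕ} {X : ℕ → ℝ}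

/-- The points of a solution together with the complement of `(-X m, X m)`. -/
def outerSet (M : ℕ) (X : ℕ → ℝ) (m : ℕ) : Set ℝ := {t | (∃ i ≤ M, X i = t) ∨ X m ≤ |t|}

/-- A row of tents over the gaps between consecutive points of a solution in `[-X m, X m]`, as the
distance from `outerSet M X m`. -/
noncomputable def tents (M : ℕ) (X : ℕ → ℝ) (m : ℕ) (t : ℝ) : ℝ :=
  Metric.infDist t (outerSet M X m)

/-- The primitive of `tents M X m` that vanishes at `0`. -/
noncomputable def tentsPrimitive (M : ℕ) (X : ℕ → ℝ) (m : ℕ) (w : ℝ) : ℝ :=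
  ∫ t in (0 : ℝ)..w, tents M X m t

theorem tents_nonneg (m : ℕ) (t : ℝ) : 0 ≤ tents M X m t := Metric.infDist_nonneg

theorem continuous_tents (m : ℕ) : Continuous (tents M X m) := Metric.continuous_infDist_pt _

theorem tents_apply_eq_zero {i : ℕ} (hi : i ≤ M) (m : ℕ) : tents M X m (X i) = 0 :=
  Metric.infDist_zero_of_mem (Or.inl ⟨i, hi, rfl⟩)

theorem tents_eq_zero_of_le_abs {m : ℕ} {t : ℝ} (ht : X m ≤ |t|) : tents M X m t = 0 :=
  Metric.infDist_zero_of_mem (Or.inr ht)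

theorem hasDerivAt_tentsPrimitive (m : ℕ) (w : ℝ) :
    HasDerivAt (tentsPrimitive M X m) (tents M X m w) w :=
  intervalIntegral.integral_hasDerivAt_right ((continuous_tents m).intervalIntegrable _ _)
    (continuous_tents m).stronglyMeasurable.stronglyMeasurableAtFilter
    (continuous_tents m).continuousAt

theorem tentsPrimitive_sub (m : ℕ) (a b : ℝ) :
    tentsPrimitive M X m b - tentsPrimitive M X m a = ∫ t in a..b, tents M X m t :=
  intervalIntegral.integral_interval_sub_left ((continuous_tents m).intervalIntegrable _ _)
    ((continuous_tents m).intervalIntegrable _ _)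

theorem tents_le (h : IsMIWSequence M X) {m : ℕ} (hm : 2 * m + 1 ≤ M) {K : ℝ} (hK : 0 < K)
    (hS : K ≤ partialSum X (m + 1)) (t : ℝ) : tents M X m t ≤ 1 / K := by
  rcases le_or_gt (X m) |t| with ht | ht
  · rw [tents_eq_zero_of_le_abs ht]
    positivity
  obtain ⟨ht1, ht2⟩ := abs_lt.1 ht
  -- the first point to the left of `t`
  have hex : ∃ j, X j ≤ t := ⟨M - m, by rw [h.symm (by omega)]; exact ht1.le⟩
  classical
  obtain ⟨j, hj⟩ : ∃ j, Nat.find hex = j := ⟨_, rfl⟩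
  have hjt : X j ≤ t := hj ▸ Nat.find_spec hex
  have hjM : j ≤ M - m := hj ▸ Nat.find_min' hex (by rw [h.symm (by omega)]; exact ht1.le)
  have hmj : m < j := by
    by_contra! hle
    have := h.anti hle (by omega)
    linarith
  obtain ⟨l, rfl⟩ : ∃ l, j = l + 1 := ⟨j - 1, by omega⟩
  have hlt : t < X l := not_le.1 (Nat.find_min hex (m := l) (by omega))
  have hKl : K ≤ partialSum X (l + 1) :=
    hS.trans (h.partialSum_le_partialSum (by omega) (by omega))
  calc tents M X m t ≤ dist t (X l) := Metric.infDist_le_dist_of_mem (Or.inl ⟨l, by omega, rfl⟩)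
    _ = X l - t := by rw [Real.dist_eq, abs_sub_comm, abs_of_pos (by linarith)]
    _ ≤ X l - X (l + 1) := by linarith
    _ = 1 / partialSum X (l + 1) := h.sub_succ (by omega)
    _ ≤ 1 / K := one_div_le_one_div_of_le hK hKl

theorem min_le_tents (h : IsMIWSequence M X) {m j : ℕ} (hmj : m ≤ j) (hj : j < M - m) (t : ℝ) :
    min (t - X (j + 1)) (X j - t) ≤ tents M X m t := by
  refine (Metric.le_infDist ⟨X 0, Or.inl ⟨0, Nat.zero_le M, rfl⟩⟩).2 fun y hy => ?_
  have hout : y ≤ X (j + 1) ∨ X j ≤ y := by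
    rcases hy with ⟨i, hi, rfl⟩ | hy
    · rcases le_or_gt i j with hij | hij
      · exact Or.inr (h.anti hij (by omega))
      · exact Or.inl (h.anti hij hi)
    · rcases le_abs'.1 hy with hy | hy
      · rw [← h.symm (by omega)] at hy
        exact Or.inl (hy.trans (h.anti (by omega) (by omega)))
      · exact Or.inr ((h.anti hmj (by omega)).trans hy)
  rw [Real.dist_eq]
  rcases hout with hy | hy
  · exact (min_le_left _ _).trans ((by linarith : t - X (j + 1) ≤ t - y).trans (le_abs_self _))
  · exact (min_le_right _ _).trans ((by linarith : X j - t ≤ -(t - y)).trans (neg_le_abs _))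

theorem abs_tentsPrimitive_le (h : IsMIWSequence M X) {m : ℕ} (hm : 2 * m + 1 ≤ M) {K : ℝ}
    (hK : 0 < K) (hS : K ≤ partialSum X (m + 1)) (w : ℝ) :
    |tentsPrimitive M X m w| ≤ X m / K := by
  have hX : 0 ≤ X m := by
    have := h.anti (show m ≤ M - m by omega) (by omega)
    rw [h.symm (by omega)] at this
    linarith
  have hclamp : tentsPrimitive M X m w = tentsPrimitive M X m (clamp (X m) w) := by
    rw [← sub_eq_zero, tentsPrimitive_sub]
    refine intervalIntegral.integral_zero_ae (Filter.Eventually.of_forall fun t ht => ?_)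
    refine tents_eq_zero_of_le_abs ?_
    simp only [clamp] at ht
    rcases le_total w (X m) with h1 | h1 <;> rcases le_total (-X m) w with h2 | h2
    · rw [min_eq_left h1, max_eq_right h2] at ht
      simp at ht
    · rw [min_eq_left h1, max_eq_left h2, Set.uIoc_of_ge h2] at ht
      exact le_abs'.2 (Or.inl ht.2)
    · rw [min_eq_right h1, max_eq_right (by linarith), Set.uIoc_of_le h1] at ht
      exact le_abs'.2 (Or.inr ht.1.le)
    · rw [min_eq_right h1, max_eq_right (by linarith), Set.uIoc_of_le h1] at ht
      exact le_abs'.2 (Or.inr ht.1.le)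
  have h1 := intervalIntegral.norm_integral_le_of_norm_le_const (a := 0) (b := clamp (X m) w)
    (f := tents M X m) (C := 1 / K) fun t _ => by
      rw [Real.norm_of_nonneg (tents_nonneg m t)]
      exact h.tents_le hm hK hS t
  rw [hclamp]
  refine h1.trans ?_
  have h2 : |clamp (X m) w - 0| ≤ X m := by
    rw [sub_zero]
    exact abs_le.2 (clamp_mem hX w)
  calc 1 / K * |clamp (X m) w - 0| ≤ 1 / K * X m := by gcongr
    _ = X m / K := by ring

/-- The tents carry a fixed fraction of the Stein functional: on each gap the factor
`partialSum X (j + 1)` cancels one power of the length of the gap. -/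
theorem half_le_sum_mul_tentsPrimitive (h : IsMIWSequence M X) {m : ℕ} (hm : 2 * m + 1 ≤ M) :
    X m / 2 ≤ ∑ i ∈ Finset.range (M + 1), X i * tentsPrimitive M X m (X i) := by
  rw [h.sum_mul_eq]
  have h1 : ∑ j ∈ Finset.Ico m (M - m), (X j - X (j + 1)) / 4 ≤
      ∑ j ∈ Finset.Ico m (M - m), partialSum X (j + 1) *
        (tentsPrimitive M X m (X j) - tentsPrimitive M X m (X (j + 1))) := by
    refine Finset.sum_le_sum fun j hj => ?_
    obtain ⟨hj1, hj2⟩ := Finset.mem_Ico.1 hj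
    have hjM : j < M := by omega
    have htent := sq_div_four_le_integral_of_tent_le (continuous_tents (M := M) (X := X) m)
      (h.lt j hjM).le fun t _ => h.min_le_tents hj1 hj2 t
    rw [tentsPrimitive_sub]
    refine le_trans (le_of_eq ?_)
      (mul_le_mul_of_nonneg_left htent (h.partialSum_pos hjM).le)
    linear_combination (-(X j - X (j + 1)) / 4) * h.partialSum_mul_sub hjM
  have h2 : ∑ j ∈ Finset.Ico m (M - m), partialSum X (j + 1) *
        (tentsPrimitive M X m (X j) - tentsPrimitive M X m (X (j + 1))) ≤
      ∑ j ∈ Finset.range M, partialSum X (j + 1) *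
        (tentsPrimitive M X m (X j) - tentsPrimitive M X m (X (j + 1))) := by
    refine Finset.sum_le_sum_of_subset_of_nonneg (fun j hj => ?_) fun j hj _ => ?_
    · rw [Finset.mem_Ico] at hj
      rw [Finset.mem_range]
      omega
    · have hjM := Finset.mem_range.1 hj
      refine mul_nonneg (h.partialSum_pos hjM).le ?_
      rw [tentsPrimitive_sub]
      exact intervalIntegral.integral_nonneg (h.lt j hjM).le fun t _ => tents_nonneg m t
  rw [← Finset.sum_div, Finset.sum_Ico_eq_sub _ (by omega), Finset.sum_range_sub',
    Finset.sum_range_sub', h.symm (by omega)] at h1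
  linarith

/-- The test function is `k w - w F w` for the tents `k` with primitive `F`, divided by its
Lipschitz constant. -/
theorem le_wassersteinDist_of_le_partialSum (h : IsMIWSequence M X) {m : ℕ} (hm : 2 * m + 1 ≤ M)
    {K : ℝ} (hK : 0 < K) (hS : K ≤ partialSum X (m + 1)) :
    ENNReal.ofReal (X m / (2 * (M + 1) * (1 + 2 * X m / K))) ≤
      wassersteinDist (empiricalDistribution (fun i : Fin (M + 1) => X i)) (gaussianReal 0 1) := by
  have hX : 0 ≤ X m := by
    have := h.anti (show m ≤ M - m by omega) (by omega)
    rw [h.symm (by omega)] at this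
    linarith
  set L := 1 + 2 * X m / K with hL
  have hLpos : 0 < L := by positivity
  set F := tentsPrimitive M X m
  set k := tents M X m
  have hFd : ∀ w, HasDerivAt F (k w) w := hasDerivAt_tentsPrimitive m
  have hFb : ∀ w, |F w| ≤ X m / K := h.abs_tentsPrimitive_le hm hK hS
  have hkb : ∀ w, |k w| ≤ 1 / K := fun w => by
    rw [abs_of_nonneg (tents_nonneg m w)]
    exact h.tents_le hm hK hS w
  have hwk : ∀ w, |w * k w| ≤ X m / K := by
    intro w
    rcases le_or_gt (X m) |w| with hw | hw
    · rw [show k w = 0 from tents_eq_zero_of_le_abs hw, mul_zero, abs_zero]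
      positivity
    · rw [abs_mul]
      calc |w| * |k w| ≤ X m * (1 / K) := by
            gcongr
            exact hkb w
        _ = X m / K := by ring
  have hwF : ∀ x y, |x * F x - y * F y| ≤ 2 * X m / K * |x - y| := by
    intro x y
    have hd : ∀ w ∈ Set.univ, HasDerivWithinAt (fun w => w * F w) (F w + w * k w) Set.univ w :=
      fun w _ => (((hasDerivAt_id w).mul (hFd w)).congr_deriv (by simp)).hasDerivWithinAt
    have hb : ∀ w ∈ Set.univ, ‖F w + w * k w‖ ≤ 2 * X m / K := fun w _ => by
      refine (norm_add_le _ _).trans ((add_le_add (hFb w) (hwk w)).trans (le_of_eq ?_))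
      ring
    exact convex_univ.norm_image_sub_le_of_norm_hasDerivWithin_le hd hb (Set.mem_univ y)
      (Set.mem_univ x)
  have hLip : LipschitzWith 1 fun w => (k w - w * F w) / L := by
    refine LipschitzWith.of_dist_le_mul fun x y => ?_
    have hk := (Metric.lipschitz_infDist_pt (outerSet M X m)).dist_le_mul x y
    rw [NNReal.coe_one, one_mul] at hk ⊢
    rw [Real.dist_eq, Real.dist_eq] at *
    rw [← sub_div, abs_div, abs_of_pos hLpos, div_le_iff₀ hLpos,
      show k x - x * F x - (k y - y * F y) = (k x - k y) - (x * F x - y * F y) by ring]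
    calc |(k x - k y) - (x * F x - y * F y)| ≤ |k x - k y| + |x * F x - y * F y| := abs_sub _ _
      _ ≤ |x - y| + 2 * X m / K * |x - y| := add_le_add hk (hwF x y)
      _ = |x - y| * L := by rw [hL]; ring
  have hγ : ∫ w, (k w - w * F w) / L ∂gaussianReal 0 1 = 0 := by
    rw [integral_div, integral_deriv_sub_mul_gaussianReal hFd (continuous_tents m) hFb hkb,
      zero_div]
  refine le_trans (ENNReal.ofReal_le_ofReal ?_) (le_iSup₂_of_le _ hLip le_rfl)
  rw [hγ, sub_zero, integral_empiricalDistribution M X (fun i => -(X i * F (X i)) / L) _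
    fun i hi => by rw [show k (X i) = 0 from tents_apply_eq_zero hi m, zero_sub],
    ← Finset.sum_div, Finset.sum_neg_distrib, neg_div, neg_div, abs_neg]
  have h1 := h.half_le_sum_mul_tentsPrimitive hm
  refine le_trans ?_ (le_abs_self _)
  calc X m / (2 * (M + 1) * L) = X m / 2 / L / (M + 1) := by
        field_simp
    _ ≤ _ := by gcongr

/-- If the number `N` of points is large, then the gaps of length at most `1 / (1 + X 0 ^ 2)` cover
the interval of all points of absolute value at most `√(log (N / 2))`. -/
theorem exists_sqrt_log_le (h : IsMIWSequence M X) (hM : 0 < M)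
    (hlarge : 32 * (4 + 2 * Real.log (M + 1)) ^ 3 ≤ M + 1) :
    ∃ m, 2 * m + 1 ≤ M ∧ 1 + X 0 ^ 2 ≤ partialSum X (m + 1) ∧
      √(Real.log ((M + 1) / 2)) ≤ X m := by
  have hX0 := h.first_pos hM
  have hM1 : (1 : ℝ) ≤ M := by exact_mod_cast hM
  set K := 1 + X 0 ^ 2 with hK
  have hKpos : 0 < K := by positivity
  obtain ⟨p, hpM, hp⟩ := h.exists_le_two_mul_first_mul_partialSum hM
  have hSp := h.partialSum_pos hpM
  set S := partialSum X (p + 1) with hSdef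
  have hy : K ≤ 4 + 2 * Real.log (M + 1) := by
    have := h.first_sq_le hM
    linarith
  -- the partial sum `S` is so large compared to `K` because `K` is only of order `log N`
  have hSK : ((M : ℝ) + 1) / 2 ≤ (S / (2 * K)) ^ 2 := by
    have h1 : (M : ℝ) ^ 2 ≤ 4 * K * S ^ 2 := by
      calc (M : ℝ) ^ 2 ≤ (2 * X 0 * S) ^ 2 := by gcongr
        _ = 4 * X 0 ^ 2 * S ^ 2 := by ring
        _ ≤ 4 * K * S ^ 2 := by
          gcongr
          rw [hK]
          linarith
    have h2 : 32 * K ^ 3 ≤ M + 1 := le_trans (by gcongr) hlarge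
    rw [div_pow, le_div_iff₀ (by positivity)]
    have h3 : 32 * K ^ 3 * (M + 1) ≤ 16 * K * S ^ 2 := by
      calc 32 * K ^ 3 * (M + 1) ≤ (M + 1) * (M + 1) := by gcongr
        _ ≤ 4 * (M : ℝ) ^ 2 := by nlinarith
        _ ≤ 16 * K * S ^ 2 := by linarith
    have h4 : K * (2 * K ^ 2 * (M + 1)) ≤ K * S ^ 2 := by linarith
    have h5 := le_of_mul_le_mul_left h4 hKpos
    linarith
  have hone : 1 ≤ S / (2 * K) := by
    have h1 : (1 : ℝ) ≤ (S / (2 * K)) ^ 2 := le_trans (by linarith) hSK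
    exact (one_le_sq_iff₀ (by positivity)).1 h1
  have hKS : K ≤ S := by
    rw [le_div_iff₀ (by positivity)] at hone
    linarith
  have hex : ∃ m, K ≤ partialSum X (m + 1) := ⟨p, hKS⟩
  classical
  -- the first partial sum to reach `K` is at most `2 * K`, as its last term is at most `K`
  obtain ⟨m, hm⟩ : ∃ m, Nat.find hex = m := ⟨_, rfl⟩
  have hKm : K ≤ partialSum X (m + 1) := hm ▸ Nat.find_spec hex
  have hmp : m ≤ p := hm ▸ Nat.find_min' hex hKS
  have hmM : 2 * m + 1 ≤ M := by
    have h1 : K ≤ partialSum X (M - 1 - m + 1) := by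
      rw [show M - 1 - m + 1 = M + 1 - (m + 1) by omega, h.partialSum_symm (by omega)]
      exact hKm
    have h2 : m ≤ M - 1 - m := hm ▸ Nat.find_min' hex (hm.symm ▸ h1)
    omega
  refine ⟨m, hmM, hKm, ?_⟩
  have hX : 0 ≤ X m := by
    have := h.anti (show m ≤ M - m by omega) (by omega)
    rw [h.symm (by omega)] at this
    linarith
  have hK0 : X 0 ≤ K := by
    rw [hK]
    nlinarith [sq_nonneg (X 0 - 1)]
  have hS2 : partialSum X (m + 1) ≤ 2 * K := by
    rcases m with _ | l
    · rw [zero_add, partialSum_one]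
      linarith
    · have h1 : partialSum X (l + 1) < K := not_le.1 (Nat.find_min hex (m := l) (by omega))
      have h2 := h.anti (Nat.zero_le (l + 1)) (by omega)
      rw [partialSum_succ]
      linarith
  have hV := h.sq_add_log_anti hmp hpM
  have hl1 : Real.log (partialSum X (m + 1)) ≤ Real.log (2 * K) :=
    Real.log_le_log (by linarith) hS2
  have hl2 : Real.log ((M + 1) / 2) ≤ 2 * (Real.log S - Real.log (2 * K)) := by
    rw [← Real.log_div hSp.ne' (by positivity)]
    refine (Real.log_le_log (by positivity) hSK).trans (le_of_eq ?_)
    rw [Real.log_pow]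
    norm_num
  refine Real.sqrt_le_iff.2 ⟨hX, ?_⟩
  linarith [sq_nonneg (X p)]

theorem le_wassersteinDist_of_large (h : IsMIWSequence M X) (hM : 0 < M)
    (hlarge : 32 * (4 + 2 * Real.log (M + 1)) ^ 3 ≤ M + 1) :
    ENNReal.ofReal (√(Real.log ((M + 1) / 2)) / (2 * (M + 1)) - 1 / (M + 1)) ≤
      wassersteinDist (empiricalDistribution (fun i : Fin (M + 1) => X i)) (gaussianReal 0 1) := by
  obtain ⟨m, hm, hS, hlog⟩ := h.exists_sqrt_log_le hM hlarge
  have hK : 0 < 1 + X 0 ^ 2 := by positivity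
  refine le_trans (ENNReal.ofReal_le_ofReal ?_) (h.le_wassersteinDist_of_le_partialSum hm hK hS)
  have hX : 0 ≤ X m := (Real.sqrt_nonneg _).trans hlog
  have hXm := h.anti (Nat.zero_le m) (by omega)
  set r := 2 * X m / (1 + X 0 ^ 2) with hr
  have hr0 : 0 ≤ r := by positivity
  have hXr : X m * r ≤ 2 := by
    rw [hr, ← mul_div_assoc, div_le_iff₀ hK]
    nlinarith
  have h1 : √(Real.log ((M + 1) / 2)) - 2 ≤ X m / (1 + r) := by
    rw [le_div_iff₀ (by positivity)]
    nlinarith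
  calc √(Real.log ((M + 1) / 2)) / (2 * (M + 1)) - 1 / (M + 1)
      = (√(Real.log ((M + 1) / 2)) - 2) / (2 * (M + 1)) := by
        field_simp
    _ ≤ X m / (1 + r) / (2 * (M + 1)) := by gcongr
    _ = X m / (2 * (M + 1) * (1 + r)) := by
        field_simp

end IsMIWSequence

/-- The size condition of `IsMIWSequence.exists_sqrt_log_le` holds eventually. -/
theorem exists_forall_log_pow_le :
    ∃ N₀ : ℕ, ∀ N : ℕ, N₀ ≤ N → 32 * (4 + 2 * Real.log N) ^ 3 ≤ (N : ℝ) := by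
  have h1 : ∀ᶠ x : ℝ in Filter.atTop, ‖Real.log x ^ 3‖ ≤ 1 / 864 * ‖x‖ :=
    (Real.isLittleO_pow_log_id_atTop (n := 3)).def (by norm_num)
  have h2 : ∀ᶠ x : ℝ in Filter.atTop, 4 ≤ Real.log x :=
    Real.tendsto_log_atTop.eventually_ge_atTop 4
  have h3 : ∀ᶠ x : ℝ in Filter.atTop, 32 * (4 + 2 * Real.log x) ^ 3 ≤ x := by
    filter_upwards [h1, h2, Filter.eventually_ge_atTop 0] with x hx1 hx2 hx3
    rw [Real.norm_of_nonneg hx3] at hx1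
    have hx4 := (le_abs_self _).trans hx1
    calc 32 * (4 + 2 * Real.log x) ^ 3 ≤ 32 * (3 * Real.log x) ^ 3 := by
          gcongr
          linarith
      _ = 864 * Real.log x ^ 3 := by ring
      _ ≤ x := by linarith
  exact Filter.eventually_atTop.1 (tendsto_natCast_atTop_atTop.eventually h3)

theorem mainTheorem1 :
    (∀ N : ℕ, 2 ≤ N → ∃! x : Fin N → ℝ, IsMIWSolution N x) ∧
    ∃ C : ℝ, 0 < C ∧ ∀ (N : ℕ), 2 ≤ N → ∀ x : Fin N → ℝ, IsMIWSolution N x →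
      (ENNReal.ofReal (1 / (2 * (N : ℝ))) ≤
          kolmogorovDist (empiricalDistribution x) (gaussianReal 0 1) ∧
        kolmogorovDist (empiricalDistribution x) (gaussianReal 0 1) ≤
          ENNReal.ofReal (55 / (N : ℝ))) ∧
      (ENNReal.ofReal (Real.sqrt (Real.log ((N : ℝ) / 2)) / (2 * (N : ℝ)) - C / (N : ℝ)) ≤
          wassersteinDist (empiricalDistribution x) (gaussianReal 0 1) ∧
        wassersteinDist (empiricalDistribution x) (gaussianReal 0 1) ≤
          ENNReal.ofReal (16 * Real.sqrt (Real.log (N : ℝ)) / (N : ℝ))) := by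
  obtain ⟨N₀, hN₀⟩ := exists_forall_log_pow_le
  refine ⟨fun N hN => ?_, 1 + √(Real.log N₀), by positivity, fun N hN x hx => ?_⟩
  · obtain ⟨M, rfl⟩ : ∃ M, N = M + 1 := ⟨N - 1, by omega⟩
    exact existsUnique_isMIWSolution M
  obtain ⟨M, rfl⟩ : ∃ M, N = M + 1 := ⟨N - 1, by omega⟩
  obtain ⟨X, rfl⟩ := exists_sequence_eq x
  have h := isMIWSolution_iff.1 hx
  have hM : 0 < M := by omega
  have hNpos : (0 : ℝ) < M + 1 := by positivity
  have hC := Real.sqrt_nonneg (Real.log N₀)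
  push_cast
  refine ⟨⟨h.le_kolmogorovDist, h.kolmogorovDist_le.trans (ENNReal.ofReal_le_ofReal ?_)⟩, ?_,
    h.wassersteinDist_le hM⟩
  · gcongr
    norm_num
  rcases le_or_gt N₀ (M + 1) with hle | hlt
  · refine le_trans (ENNReal.ofReal_le_ofReal ?_)
      (h.le_wassersteinDist_of_large hM (by simpa using hN₀ (M + 1) hle))
    gcongr
    linarith
  · -- for the finitely many remaining `N` the left-hand side is not positive
    rw [ENNReal.ofReal_of_nonpos]
    · exact zero_le
    have h1 : √(Real.log (((M : ℝ) + 1) / 2)) ≤ √(Real.log N₀) := by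
      have h2 : (M : ℝ) + 1 ≤ N₀ := by exact_mod_cast hlt.le
      gcongr
      linarith
    rw [sub_nonpos]
    calc √(Real.log (((M : ℝ) + 1) / 2)) / (2 * (M + 1)) ≤ √(Real.log N₀) / (M + 1) := by
          gcongr
          linarith
      _ ≤ (1 + √(Real.log N₀)) / (M + 1) := by
          gcongr
          linarith
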